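/- Let $\lambda>0$, $d\ge 0$, $m\ge 1$, $a_1,\dots,a_m\in\mathbb R^d$, $b_1,\dots,b_m\in\mathbb R$, and let $$f(x)=\lambda\|x\|_1+\frac1m\sum_{i=1}^m\max\{0,\,1-b_i\langle a_i,x\rangle\},\qquad x\in\mathbb R^d .$$ Let $\tilde{\mathbf Q}\in\mathbb R^{m\times d}$ be the matrix with rows $b_ia_i^\top$, let $\sigma=\|\tilde{\mathbf Q}^\top\tilde{\mathbf Q}\|$ (the largest eigenvalue), let $x^*$ be any minimizer of $f$, let $x_0\in\mathbb R^d$ and $\varepsilon>0$, and let $\|\cdot\|$ be the Euclidean norm on $\mathbb R^d$. For $\mu>0$ let $$f_\mu(x)=\lambda\sum_{j=1}^d\mu\log\bigl(e^{x_j/\mu}+e^{-x_j/\mu}\bigr)+\frac1m\sum_{i=1}^m\mu\log\bigl(1+e^{(1-b_i\langle a_i,x\rangle)/\mu}\bigr)$$ be the softmax smoothing of $f$, and fix $\mu=\varepsilon/(4\max\{1,\lambda d\})$. An iterative method knows $d,m,\lambda,\sigma,\varepsilon$, the starting point $x_0$ and the number $N$ of iterations to be made. It sees the data $a_i,b_i$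 only through two exact oracles, which it may query adaptively: a gradient oracle, which returns $\nabla f_\mu(x)$ for a query $x$, and a linear system solver, which for a query $(x,\tau,w)$ with $\tau>0$ returns the solution $\phi$ of $(\nabla^2f_\mu(x)+\tau I)\phi=w$. There are a universal constant $C>0$, a universal exponent $p\in\mathbb N$ and an iterative method, initialized with $x_0$, such that for all data as above, after $$N=\left\lfloor C\,\frac{\max\{1,\lambda d\}^{3/5}\,\bigl(\lambda d+\|\tilde{\mathbf Q}^\top\tilde{\mathbf Q}\|^2\bigr)^{1/5}\,\|x_0-x^*\|^{4/5}}{\varepsilon^{4/5}}\right\rfloor$$ iterations the current point $x_N$ satisfies $f(x_N)-f(x^*)\le\varepsilon$, and each of these $N$ iterations makes at most $C\log^{p}(2+\mathcal Z/\varepsilon)$ calls to the gradient oracle and the linear system solver in total, where $\mathcal Z=(2+d+m+\lambda+\sigma+\|x_0-x^*\|)^p$. In particular, if $\lambda d\ge 1$, the number of iterations is $O\bigl((\lambda d)^{3/5}(\lambda d+\|\tilde{\mathbf Q}^\top\tilde{\mathbf Q}\|^2)^{1/5}\|x_0-x^*\|^{4/5}/\varepsilon^{4/5}\bigr)$. 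-/

import Mathlib

open scoped Matrix

noncomputable section

namespace L1SVM

/-! ### The objective -/

/-- The `l1`-SVM objective `lam * ‖x‖₁ + (1/m) * ∑ i, max {0, 1 - b i * ⟨a i, x⟩}`. -/
def objective {d m : ℕ} (lam : ℝ) (a : Fin m → EuclideanSpace ℝ (Fin d)) (b : Fin m → ℝ)
    (x : EuclideanSpace ℝ (Fin d)) : ℝ :=
  lam * ∑ j, |x j| + (1 / (m : ℝ)) * ∑ i, max 0 (1 - b i * inner ℝ (a i) x)

/-- The matrix whose `i`-th row is `b i • a i`. -/
def dataMatrix {d m : ℕ} (a : Fin m → EuclideanSpace ℝ (Fin d)) (b : Fin m → ℝ) :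
    Matrix (Fin m) (Fin d) ℝ :=
  Matrix.of fun i j => b i * a i j

/-- The Euclidean operator norm of `Qᵀ * Q`, i.e. the largest eigenvalue of this positive
semidefinite matrix. -/
def gramNorm {d m : ℕ} (Q : Matrix (Fin m) (Fin d) ℝ) : ℝ :=
  ‖Matrix.toEuclideanCLM (𝕜 := ℝ) (Qᵀ * Q)‖

/-! ### Softmax smoothing -/

/-- Softmax: `μ * log (∑ i, exp (y i / μ))`. -/
def smax {k : ℕ} (μ : ℝ) (y : Fin k → ℝ) : ℝ :=
  μ * Real.log (∑ i, Real.exp (y i / μ))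

/-- Smooth absolute value. -/
def sabs (μ c : ℝ) : ℝ := smax μ ![c, -c]

/-- Smooth `l1` norm. -/
def softl1 {k : ℕ} (μ : ℝ) (y : Fin k → ℝ) : ℝ := ∑ i, sabs μ (y i)

/-- Smooth positive part. -/
def shinge (μ c : ℝ) : ℝ := smax μ ![0, c]

/-- Smooth averaged hinge loss. -/
def ssvm {m : ℕ} (μ : ℝ) (y : Fin m → ℝ) : ℝ := (1 / (m : ℝ)) * ∑ i, shinge μ (1 - y i)

/-- The smoothed `l1`-SVM objective with smoothing parameter `μ`. -/
def smoothed {d m : ℕ} (lam : ℝ) (a : Fin m → EuclideanSpace ℝ (Fin d)) (b : Fin m → ℝ)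
    (μ : ℝ) (x : EuclideanSpace ℝ (Fin d)) : ℝ :=
  lam * softl1 μ (fun j => x j) + ssvm μ (dataMatrix a b *ᵥ fun j => x j)

/-- The smoothing parameter used for accuracy `ε`; it is `ε / (4 * lam * d)` if `1 ≤ lam * d`. -/
def smoothingParam (d : ℕ) (lam ε : ℝ) : ℝ := ε / (4 * max 1 (lam * d))

/-! ### Oracle model

A method sees the data `a`, `b` only through the answers to its queries. A query asks for a
gradient, or for the solution `φ` of a regularized Newton system `(∇²F(x) + τ I) φ = w` with
`τ > 0`. -/

/-- A call to the gradient oracle (`grad`) or to the linear system solver (`solve`). -/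
inductive Query (d : ℕ) : Type
  | grad (x : EuclideanSpace ℝ (Fin d)) : Query d
  | solve (x : EuclideanSpace ℝ (Fin d)) (τ : {t : ℝ // 0 < t})
      (w : EuclideanSpace ℝ (Fin d)) : Query d

/-- The exact answers for a function `F`. For a convex `C²` function `F` the operator
`∇²F(x) + τ I` is invertible for every `τ > 0`. -/
def answer {d : ℕ} (F : EuclideanSpace ℝ (Fin d) → ℝ) : Query d → EuclideanSpace ℝ (Fin d)
  | .grad x => gradient F x
  | .solve x τ w =>
      ContinuousLinearMap.inverse
        (fderiv ℝ (gradient F) x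
          + τ.1 • ContinuousLinearMap.id ℝ (EuclideanSpace ℝ (Fin d))) w

/-- A terminating adaptive sequence of queries, each one depending on the earlier answers,
which ends by returning an element of `α`. -/
inductive OracleProg (d : ℕ) (α : Type) : Type
  | done (r : α) : OracleProg d α
  | call (q : Query d) (next : EuclideanSpace ℝ (Fin d) → OracleProg d α) : OracleProg d α

/-- The value returned when the queries are answered by `O`. -/
def OracleProg.result {d : ℕ} {α : Type} (O : Query d → EuclideanSpace ℝ (Fin d)) :
    OracleProg d α → α
  | .done r => r
  | .call q next => OracleProg.result O (next (O q))

/-- The number of oracle calls made when the queries are answered by `O`. -/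
def OracleProg.calls {d : ℕ} {α : Type} (O : Query d → EuclideanSpace ℝ (Fin d)) :
    OracleProg d α → ℕ
  | .done _ => 0
  | .call q next => OracleProg.calls O (next (O q)) + 1

/-- An iterative method on `ℝ^d`: it is initialized at a given point, an iteration makes finitely
many oracle calls and updates the state (the memory), and a state shows the current point. -/
structure IterMethod (d : ℕ) : Type 1 where
  State : Type
  init : EuclideanSpace ℝ (Fin d) → State
  step : State → OracleProg d State
  point : State → EuclideanSpace ℝ (Fin d)
  point_init : ∀ x, point (init x) = x

/-- The state after `k` iterations from `x₀`. -/
def IterMethod.stateAt {d : ℕ} (M : IterMethod d) (O : Query d → EuclideanSpace ℝ (Fin d))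
    (x₀ : EuclideanSpace ℝ (Fin d)) : ℕ → M.State
  | 0 => M.init x₀
  | k + 1 => (M.step (M.stateAt O x₀ k)).result O

/-- The point `x_k` after `k` iterations from `x₀`. -/
def IterMethod.iterate {d : ℕ} (M : IterMethod d) (O : Query d → EuclideanSpace ℝ (Fin d))
    (x₀ : EuclideanSpace ℝ (Fin d)) (k : ℕ) : EuclideanSpace ℝ (Fin d) :=
  M.point (M.stateAt O x₀ k)

/-- The number of oracle calls made in the iteration that leads from `x_k` to `x_{k+1}`. -/
def IterMethod.callsAt {d : ℕ} (M : IterMethod d) (O : Query d → EuclideanSpace ℝ (Fin d))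
    (x₀ : EuclideanSpace ℝ (Fin d)) (k : ℕ) : ℕ :=
  (M.step (M.stateAt O x₀ k)).calls O

/-! ### The complexity bounds -/

/-- The iteration bound
`max {1, lam d}^(3/5) * (lam d + σ²)^(1/5) * R^(4/5) / ε^(4/5)`. -/
def iterBound (d : ℕ) (lam σ R ε : ℝ) : ℝ :=
  (max 1 (lam * d)) ^ (3 / 5 : ℝ) * (lam * d + σ ^ 2) ^ (1 / 5 : ℝ) * R ^ (4 / 5 : ℝ)
    / ε ^ (4 / 5 : ℝ)

/-- A polynomial in the problem parameters. -/
def paramZ (p d m : ℕ) (lam σ R : ℝ) : ℝ := (2 + d + m + lam + σ + R) ^ p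

end L1SVM

end

/-!
The method is an accelerated proximal point method in which the proximal subproblems are solved by
Newton-type steps, at a cost that is logarithmic in all parameters.

*Structure of the objective.* The smoothed objective is a linear function plus a weighted sum of
functions `μ * log (1 + exp ((⟪v k, x⟫ + c k) / μ))` (`svmSum`, `smoothed_eq_val`). The square root of
the second derivative of `t ↦ log (1 + exp t)` is Lipschitz. Hence the Hessians at points at
distance `r` agree up to a factor two and an error `Λ r²`, where `Λ` is, up to constants,
`(λ + σ²) / μ³` (`SoftplusSum.Bounded.form_le_two_mul`). No third derivatives are used, and averaged
Hessians along a segment come from the mean value theorem in one variable.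

*Proximal subproblems.* Let `y(τ)` minimize `f y + τ / 2 * ‖y - q‖²`. In a ball of radius `r` with
`Λ r² ≤ τ`, the Hessian of this objective at the centre of the ball is a preconditioner with constant
condition number, so preconditioned gradient steps, each with one gradient and one linear system,
converge linearly (`SoftplusSum.Bounded.newtonStep_iterate`). For large `τ` one can start from `q`
because the gradients are bounded. Then `τ` is decreased by the factor `15 / 16` again and again, and
the preconditioner is recomputed at the last approximate solution. This works as long as
`Λ ‖y - q‖² ≤ τ` (`SoftplusSum.Bounded.resid_continue`). So for every `ℓ > 0` one finds an
approximate proximal point for some `τ ≥ ℓ`, and `τ > ℓ` only if `Λ ‖y - q‖² > τ`, i.e. if the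
movement is large (`SoftplusSum.Bounded.result_proxProg`).

*Acceleration.* The weight `A` of the current point prescribes `ℓ`. If the proximal point is found for
`τ = ℓ`, then the iteration is the usual one and raises the level `(A / scale) ^ (1 / 5)` by one. If
`τ > ℓ`, then the progress is damped by `ℓ / τ`, and the energy decreases by a multiple of
`A ℓ ‖y - q‖²`, which is bounded below because the movement is large
(`SoftplusSum.Bounded.energy_le`). As the energy is bounded, the damped iterations are at most about
as many as the undamped ones (`AccelParams.Good.val_iterate_sub_le`), and `N` iterations lead to a
weight of order `N ^ 5 / (Λ R²)`. The comparison point minimizes the original objective and not the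
smoothed one; the energy is nevertheless bounded below up to the smoothing error, as long as the
method has not reached its target weight.

*Parameters.* The method is not told `‖x₀ - x*‖`, but the prescribed number `N` of iterations
determines this distance up to a constant factor (`radius`). If `N = 0`, then the bound on `N` forces
the Lipschitz bound for the objective below `ε`.
-/

noncomputable section

namespace L1SVM

/-! ### The curvature of the softplus function -/

/-- The second derivative of the softplus function `t ↦ log (1 + exp t)`. -/
def sigCurv (t : ℝ) : ℝ := Real.sigmoid t * (1 - Real.sigmoid t)

lemma sigCurv_pos (t : ℝ) : 0 < sigCurv t :=
  mul_pos (Real.sigmoid_pos t) (sub_pos.2 (Real.sigmoid_lt_one t))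

lemma sigCurv_le (t : ℝ) : sigCurv t ≤ 1 / 4 := by
  unfold sigCurv
  nlinarith [sq_nonneg (Real.sigmoid t - 1 / 2)]

lemma hasDerivAt_softplus (t : ℝ) :
    HasDerivAt (fun t => Real.log (1 + Real.exp t)) (Real.sigmoid t) t := by
  have h := ((Real.hasDerivAt_exp t).const_add 1).log (by positivity)
  convert h using 1
  rw [Real.sigmoid_def, Real.exp_neg]
  field_simp
  ring

/-- The square root of the curvature is Lipschitz. This is what makes second derivatives at
nearby points comparable. -/
lemma abs_sqrt_sigCurv_sub_le (s t : ℝ) :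
    |√(sigCurv s) - √(sigCurv t)| ≤ 1 / 4 * |s - t| := by
  have hd : ∀ x : ℝ, HasDerivAt (fun x => √(sigCurv x))
      (√(sigCurv x) * (1 - 2 * Real.sigmoid x) / 2) x := by
    intro x
    have h0 := Real.hasDerivAt_sigmoid x
    have h1 : HasDerivAt sigCurv (sigCurv x * (1 - 2 * Real.sigmoid x)) x := by
      refine (h0.mul (h0.const_sub 1)).congr_deriv ?_
      unfold sigCurv
      ring
    have h2 := h1.sqrt (sigCurv_pos x).ne'
    convert h2 using 1
    have h3 : √(sigCurv x) ≠ 0 := (Real.sqrt_pos.2 (sigCurv_pos x)).ne'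
    rw [eq_div_iff (by positivity), div_mul_eq_mul_div, div_eq_iff (by norm_num)]
    have := Real.mul_self_sqrt (sigCurv_pos x).le
    linear_combination (2 * (1 - 2 * Real.sigmoid x)) * this
  have := Convex.norm_image_sub_le_of_norm_hasDerivWithin_le (C := 1 / 4) (s := Set.univ)
    (f := fun x => √(sigCurv x)) (x := t) (y := s)
    (fun x _ => (hd x).hasDerivWithinAt) (fun x _ => ?_) convex_univ trivial trivial
  · simpa [Real.norm_eq_abs] using this
  · have h4 : √(sigCurv x) ≤ 1 / 2 := by
      rw [Real.sqrt_le_left (by norm_num)]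
      exact (sigCurv_le x).trans (by norm_num)
    have h5 : |1 - 2 * Real.sigmoid x| ≤ 1 := by
      rw [abs_le]
      constructor <;> linarith [Real.sigmoid_pos x, Real.sigmoid_lt_one x]
    rw [Real.norm_eq_abs, abs_div, abs_mul, abs_of_nonneg (Real.sqrt_nonneg _), abs_two]
    nlinarith [Real.sqrt_nonneg (sigCurv x), abs_nonneg (1 - 2 * Real.sigmoid x)]

/-- Curvatures at different points agree up to a factor two and a quadratic error. -/
lemma sigCurv_le_two_mul_add (s t : ℝ) : sigCurv s ≤ 2 * sigCurv t + (s - t) ^ 2 / 8 := by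
  have h := abs_sqrt_sigCurv_sub_le s t
  have hs := Real.sq_sqrt (sigCurv_pos s).le
  have ht := Real.sq_sqrt (sigCurv_pos t).le
  have h2 : (√(sigCurv s) - √(sigCurv t)) ^ 2 ≤ (1 / 4 * |s - t|) ^ 2 := by
    rw [← sq_abs (√(sigCurv s) - √(sigCurv t))]
    gcongr
  rw [mul_pow, sq_abs] at h2
  nlinarith [sq_nonneg (√(sigCurv s) - 2 * √(sigCurv t))]

/-! ### Sums of softplus ridge functions -/

/-- The data of a function `x ↦ ⟪lin, x⟫ + ∑ k, w k * (μ * log (1 + exp ((⟪v k, x⟫ + c k) / μ)))`.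
-/
structure SoftplusSum (E ι : Type*) where
  /-- the linear part -/
  lin : E
  /-- the weights -/
  w : ι → ℝ
  /-- the directions of the ridge functions -/
  v : ι → E
  /-- the offsets of the ridge functions -/
  c : ι → ℝ
  /-- the smoothing parameter -/
  μ : ℝ

namespace SoftplusSum

variable {E ι : Type*} [NormedAddCommGroup E] [InnerProductSpace ℝ E]
  (P : SoftplusSum E ι)

/-- The argument at which the `k`-th softplus function is evaluated. -/
def arg (x : E) (k : ι) : ℝ := (inner ℝ (P.v k) x + P.c k) / P.μ

lemma hasFDerivAt_arg (x : E) (k : ι) :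
    HasFDerivAt (fun x => P.arg x k) (P.μ⁻¹ • innerSL ℝ (P.v k)) x := by
  have h : HasFDerivAt (fun x => inner ℝ (P.v k) x) (innerSL ℝ (P.v k)) x :=
    (innerSL ℝ (P.v k)).hasFDerivAt
  have h2 := (h.add_const (P.c k)).mul_const P.μ⁻¹
  simpa only [arg, div_eq_mul_inv] using h2

variable [Fintype ι]

/-- The value of the function. -/
def val (x : E) : ℝ :=
  inner ℝ P.lin x + ∑ k, P.w k * (P.μ * Real.log (1 + Real.exp (P.arg x k)))

/-- The gradient of the function. -/
def grad (x : E) : E := P.lin + ∑ k, (P.w k * Real.sigmoid (P.arg x k)) • P.v k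

/-- The operator `∑ k, w k * θ k * v k (v k)ᵀ`. -/
def form (θ : ι → ℝ) : E →L[ℝ] E :=
  ∑ k, (P.w k * θ k) • (innerSL ℝ (P.v k)).smulRight (P.v k)

/-- The Hessian of the function. -/
def hess (x : E) : E →L[ℝ] E := P.form fun k => sigCurv (P.arg x k) / P.μ

lemma form_apply (θ : ι → ℝ) (u : E) :
    P.form θ u = ∑ k, (P.w k * θ k * inner ℝ (P.v k) u) • P.v k := by
  simp [form, smul_smul, mul_assoc]

lemma inner_form (θ : ι → ℝ) (u z : E) :
    inner ℝ (P.form θ u) z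
      = ∑ k, P.w k * θ k * (inner ℝ (P.v k) u * inner ℝ (P.v k) z) := by
  rw [form_apply, sum_inner]
  refine Finset.sum_congr rfl fun k _ => ?_
  rw [real_inner_smul_left]
  ring

lemma inner_form_comm (θ : ι → ℝ) (u z : E) :
    inner ℝ (P.form θ u) z = inner ℝ (P.form θ z) u := by
  simp only [inner_form]
  exact Finset.sum_congr rfl fun k _ => by ring

lemma inner_form_self (θ : ι → ℝ) (u : E) :
    inner ℝ (P.form θ u) u = ∑ k, P.w k * θ k * inner ℝ (P.v k) u ^ 2 := by
  rw [inner_form]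
  exact Finset.sum_congr rfl fun k _ => by ring

lemma inner_form_self_nonneg (hw : ∀ k, 0 ≤ P.w k) {θ : ι → ℝ} (hθ : ∀ k, 0 ≤ θ k) (u : E) :
    0 ≤ inner ℝ (P.form θ u) u := by
  rw [inner_form_self]
  exact Finset.sum_nonneg fun k _ =>
    mul_nonneg (mul_nonneg (hw k) (hθ k)) (sq_nonneg _)

lemma hasGradientAt_val [CompleteSpace E] (hμ : 0 < P.μ) (x : E) :
    HasGradientAt P.val (P.grad x) x := by
  rw [hasGradientAt_iff_hasFDerivAt]
  have h1 : HasFDerivAt (fun x => inner ℝ P.lin x) (innerSL ℝ P.lin) x :=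
    (innerSL ℝ P.lin).hasFDerivAt
  have h2 : ∀ k ∈ Finset.univ, HasFDerivAt
      (fun x => P.w k * (P.μ * Real.log (1 + Real.exp (P.arg x k))))
      (P.w k • (P.μ • (Real.sigmoid (P.arg x k) • (P.μ⁻¹ • innerSL ℝ (P.v k))))) x := fun k _ =>
    (((hasDerivAt_softplus _).comp_hasFDerivAt x (P.hasFDerivAt_arg x k)).const_mul _).const_mul _
  have h3 := h1.add (HasFDerivAt.fun_sum h2)
  refine h3.congr_fderiv ?_
  ext u
  simp only [grad, map_add, map_sum, map_smul, add_apply, sum_apply,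
    smul_apply, innerSL_apply_apply, InnerProductSpace.toDual_apply_apply,
    smul_eq_mul]
  congr 1
  refine Finset.sum_congr rfl fun k _ => ?_
  field_simp

lemma hasFDerivAt_grad (x : E) : HasFDerivAt P.grad (P.hess x) x := by
  have h2 : ∀ k ∈ Finset.univ, HasFDerivAt
      (fun x => (P.w k * Real.sigmoid (P.arg x k)) • P.v k)
      ((P.w k • ((sigCurv (P.arg x k)) • (P.μ⁻¹ • innerSL ℝ (P.v k)))).smulRight (P.v k)) x :=
    fun k _ => (((Real.hasDerivAt_sigmoid _).comp_hasFDerivAt x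
      (P.hasFDerivAt_arg x k)).const_mul _).smul_const _
  have h3 := (HasFDerivAt.fun_sum h2).const_add P.lin
  refine h3.congr_fderiv ?_
  ext u
  simp only [hess, form_apply, sum_apply,
    smul_apply, innerSL_apply_apply, ContinuousLinearMap.smulRight_apply,
    smul_eq_mul]
  refine Finset.sum_congr rfl fun k _ => ?_
  congr 1
  ring

/-- The gradient inequality of convexity. -/
lemma val_add_inner_le (hμ : 0 < P.μ) (hw : ∀ k, 0 ≤ P.w k) (y u : E) :
    P.val y + inner ℝ (P.grad y) (u - y) ≤ P.val u := by
  -- the softplus function lies above its tangents because its derivative is monotone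
  have key : ∀ s t : ℝ, Real.log (1 + Real.exp s) + Real.sigmoid s * (t - s)
      ≤ Real.log (1 + Real.exp t) := by
    intro s t
    have hc : ConvexOn ℝ Set.univ (fun t => Real.log (1 + Real.exp t)) := by
      refine Monotone.convexOn_univ_of_deriv
        (fun t => (hasDerivAt_softplus t).differentiableAt) ?_
      have : deriv (fun t => Real.log (1 + Real.exp t)) = Real.sigmoid :=
        funext fun t => (hasDerivAt_softplus t).deriv
      rw [this]
      exact Real.sigmoid_monotone
    rcases lt_trichotomy s t with h | h | h
    · have := hc.le_slope_of_hasDerivAt trivial trivial h (hasDerivAt_softplus s)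
      rw [slope_def_field, le_div_iff₀ (by linarith)] at this
      linarith
    · subst h; simp
    · have := hc.slope_le_of_hasDerivAt trivial trivial h (hasDerivAt_softplus s)
      rw [slope_def_field, div_le_iff₀ (by linarith)] at this
      linarith
  have hsum : ∑ k, P.w k * (P.μ * Real.log (1 + Real.exp (P.arg y k)))
      + ∑ k, P.w k * Real.sigmoid (P.arg y k) * inner ℝ (P.v k) (u - y)
      ≤ ∑ k, P.w k * (P.μ * Real.log (1 + Real.exp (P.arg u k))) := by
    rw [← Finset.sum_add_distrib]
    refine Finset.sum_le_sum fun k _ => ?_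
    have h1 : inner ℝ (P.v k) (u - y) = P.μ * (P.arg u k - P.arg y k) := by
      rw [arg, arg, inner_sub_right]
      field_simp
      ring
    rw [h1]
    have h2 := mul_le_mul_of_nonneg_left (key (P.arg y k) (P.arg u k))
      (mul_nonneg (hw k) hμ.le)
    linarith
  simp only [val, grad, inner_add_left, sum_inner, real_inner_smul_left, inner_sub_right,
    mul_sub, Finset.sum_sub_distrib] at hsum ⊢
  linarith

/-- A difference of gradients is an averaged Hessian applied to the difference of the points; the
average is taken separately for every ridge function. -/
lemma exists_grad_sub_eq (hμ : 0 < P.μ) (y z : E) :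
    ∃ t : ι → ℝ, P.grad y - P.grad z = P.form (fun k => sigCurv (t k) / P.μ) (y - z) ∧
      ∀ k, t k ∈ Set.uIcc (P.arg y k) (P.arg z k) := by
  have key : ∀ k, ∃ t ∈ Set.uIcc (P.arg y k) (P.arg z k),
      Real.sigmoid (P.arg y k) - Real.sigmoid (P.arg z k)
        = sigCurv t * (P.arg y k - P.arg z k) := by
    intro k
    have mvt : ∀ a b : ℝ, a < b → ∃ t ∈ Set.uIcc a b,
        Real.sigmoid b - Real.sigmoid a = sigCurv t * (b - a) := by
      intro a b hab
      obtain ⟨t, ht, h⟩ := exists_hasDerivAt_eq_slope Real.sigmoid sigCurv hab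
        continuous_sigmoid.continuousOn (fun x _ => Real.hasDerivAt_sigmoid x)
      refine ⟨t, Set.Icc_subset_uIcc ⟨ht.1.le, ht.2.le⟩, ?_⟩
      rw [h, div_mul_cancel₀ _ (by linarith)]
    rcases lt_trichotomy (P.arg y k) (P.arg z k) with h | h | h
    · obtain ⟨t, ht, e⟩ := mvt _ _ h
      exact ⟨t, ht, by linarith⟩
    · exact ⟨P.arg y k, Set.left_mem_uIcc, by simp [h]⟩
    · obtain ⟨t, ht, e⟩ := mvt _ _ h
      exact ⟨t, by rwa [Set.uIcc_comm], by linarith⟩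
  choose t ht e using key
  refine ⟨t, ?_, ht⟩
  rw [grad, grad, form_apply, add_sub_add_left_eq_sub, ← Finset.sum_sub_distrib]
  refine Finset.sum_congr rfl fun k _ => ?_
  rw [← sub_smul, ← mul_sub, e k, inner_sub_right, arg, arg]
  congr 1
  field_simp
  ring

/-- The quantitative assumptions on a sum of softplus ridge functions: a bound `L₂` for the
quadratic form, a bound `L₄` for the quartic form, and a bound `G` for the gradient. -/
structure Bounded (L₂ L₄ G : ℝ) : Prop where
  μ_pos : 0 < P.μ
  w_nonneg : ∀ k, 0 ≤ P.w k
  quad : ∀ u, ∑ k, P.w k * inner ℝ (P.v k) u ^ 2 ≤ L₂ * ‖u‖ ^ 2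
  quart : ∀ u z, ∑ k, P.w k * (inner ℝ (P.v k) u ^ 2 * inner ℝ (P.v k) z ^ 2)
    ≤ L₄ * ‖u‖ ^ 2 * ‖z‖ ^ 2
  grad_le : ∀ x, ‖P.grad x‖ ≤ G
  L₂_nonneg : 0 ≤ L₂
  L₄_nonneg : 0 ≤ L₄

variable {P} {L₂ L₄ G : ℝ}

lemma Bounded.form_le (hP : P.Bounded L₂ L₄ G) (t : ι → ℝ) (u : E) :
    inner ℝ (P.form (fun k => sigCurv (t k) / P.μ) u) u ≤ L₂ / (4 * P.μ) * ‖u‖ ^ 2 := by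
  have hμ := hP.μ_pos
  rw [inner_form_self]
  calc ∑ k, P.w k * (sigCurv (t k) / P.μ) * inner ℝ (P.v k) u ^ 2
      ≤ ∑ k, 1 / (4 * P.μ) * (P.w k * inner ℝ (P.v k) u ^ 2) := by
        refine Finset.sum_le_sum fun k _ => ?_
        have h1 : sigCurv (t k) / P.μ ≤ 1 / (4 * P.μ) := by
          rw [div_le_div_iff₀ hμ (by positivity)]
          nlinarith [sigCurv_le (t k)]
        have h2 := mul_le_mul_of_nonneg_right h1
          (mul_nonneg (hP.w_nonneg k) (sq_nonneg (inner ℝ (P.v k) u)))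
        linarith
    _ ≤ 1 / (4 * P.μ) * (L₂ * ‖u‖ ^ 2) := by
        rw [← Finset.mul_sum]
        exact mul_le_mul_of_nonneg_left (hP.quad u) (by positivity)
    _ = L₂ / (4 * P.μ) * ‖u‖ ^ 2 := by ring

/-- Averaged Hessians over a ball are comparable up to a multiple of the identity that is quadratic
in the radius. -/
lemma Bounded.form_le_two_mul (hP : P.Bounded L₂ L₄ G) {s t : ι → ℝ} {p q : E} {r : ℝ}
    (hp : ‖p‖ ≤ r) (hq : ‖q‖ ≤ r)
    (hst : ∀ k, (P.μ * (s k - t k)) ^ 2 ≤ inner ℝ (P.v k) p ^ 2 + inner ℝ (P.v k) q ^ 2) (u : E) :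
    inner ℝ (P.form (fun k => sigCurv (s k) / P.μ) u) u
      ≤ 2 * inner ℝ (P.form (fun k => sigCurv (t k) / P.μ) u) u
        + L₄ / (4 * P.μ ^ 3) * r ^ 2 * ‖u‖ ^ 2 := by
  have hμ := hP.μ_pos
  have hL := hP.L₄_nonneg
  rw [inner_form_self, inner_form_self]
  have h1 : ∑ k, P.w k * (sigCurv (s k) / P.μ) * inner ℝ (P.v k) u ^ 2
      ≤ ∑ k, (2 * (P.w k * (sigCurv (t k) / P.μ) * inner ℝ (P.v k) u ^ 2)
        + 1 / (8 * P.μ ^ 3) * (P.w k * (inner ℝ (P.v k) p ^ 2 * inner ℝ (P.v k) u ^ 2)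
          + P.w k * (inner ℝ (P.v k) q ^ 2 * inner ℝ (P.v k) u ^ 2))) := by
    refine Finset.sum_le_sum fun k _ => ?_
    have h2 : sigCurv (s k) / P.μ ≤ 2 * (sigCurv (t k) / P.μ)
        + 1 / (8 * P.μ ^ 3) * (inner ℝ (P.v k) p ^ 2 + inner ℝ (P.v k) q ^ 2) := by
      have h3 := sigCurv_le_two_mul_add (s k) (t k)
      calc sigCurv (s k) / P.μ ≤ (2 * sigCurv (t k) + (s k - t k) ^ 2 / 8) / P.μ := by gcongr
        _ = 2 * (sigCurv (t k) / P.μ) + 1 / (8 * P.μ ^ 3) * (P.μ * (s k - t k)) ^ 2 := by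
          field_simp
        _ ≤ _ := by
          have := hst k
          gcongr
    have h4 := mul_le_mul_of_nonneg_right h2
      (mul_nonneg (hP.w_nonneg k) (sq_nonneg (inner ℝ (P.v k) u)))
    linarith
  refine h1.trans ?_
  rw [Finset.sum_add_distrib, ← Finset.mul_sum, ← Finset.mul_sum, Finset.sum_add_distrib]
  have h5 : ∀ z : E, ‖z‖ ≤ r →
      ∑ k, P.w k * (inner ℝ (P.v k) z ^ 2 * inner ℝ (P.v k) u ^ 2) ≤ L₄ * r ^ 2 * ‖u‖ ^ 2 := by
    intro z hz
    refine (hP.quart z u).trans ?_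
    gcongr
  have h6 := mul_le_mul_of_nonneg_left (add_le_add (h5 p hp) (h5 q hq))
    (show 0 ≤ 1 / (8 * P.μ ^ 3) by positivity)
  refine (add_le_add_right h6 _).trans (le_of_eq ?_)
  ring

end SoftplusSum

/-! ### Preconditioned gradient steps -/

section Preconditioning

variable {E : Type*} [NormedAddCommGroup E] [InnerProductSpace ℝ E]

/-- If two quadratic forms `H` and `M` agree up to a factor two, then a gradient step for `M` that is
preconditioned by `H` contracts the norm given by `H`. -/
lemma inner_precond_step_le {H M : E →L[ℝ] E}
    (hH : ∀ u z, inner ℝ (H u) z = inner ℝ (H z) u)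
    (hM : ∀ u z, inner ℝ (M u) z = inner ℝ (M z) u)
    (hM0 : ∀ u, 0 ≤ inner ℝ (M u) u)
    (hHM : ∀ u, inner ℝ (H u) u ≤ 2 * inner ℝ (M u) u)
    (hMH : ∀ u, inner ℝ (M u) u ≤ 2 * inner ℝ (H u) u) {u z : E} (h : H z = M u) :
    inner ℝ (H (u - (1 / 2 : ℝ) • z)) (u - (1 / 2 : ℝ) • z) ≤ 3 / 4 * inner ℝ (H u) u := by
  have h1 : inner ℝ (H z) z ≤ 2 * inner ℝ (M u) u := by
    have h2 := hM0 ((2 : ℝ) • u - z)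
    have h3 := hMH z
    have h4 := hM z u
    rw [← h] at h4
    simp only [map_sub, map_smul, inner_sub_left, inner_sub_right, real_inner_smul_left,
      real_inner_smul_right, ← h] at h2
    rw [h] at h2 h4 ⊢
    rw [h] at h3
    linarith
  have h5 := hHM u
  have h6 := hH u z
  simp only [map_sub, map_smul, inner_sub_left, inner_sub_right, real_inner_smul_left,
      real_inner_smul_right]
  rw [h6]
  rw [h] at h1 ⊢
  linarith

/-- For a positive semidefinite form bounded by `b`, the squared norm of the image is at most `b`
times the form. -/
lemma norm_sq_apply_le {H : E →L[ℝ] E} {b : ℝ} (hb : 0 ≤ b)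
    (hH : ∀ u z, inner ℝ (H u) z = inner ℝ (H z) u) (hH0 : ∀ u, 0 ≤ inner ℝ (H u) u)
    (hHb : ∀ u, inner ℝ (H u) u ≤ b * ‖u‖ ^ 2) (u : E) :
    ‖H u‖ ^ 2 ≤ b * inner ℝ (H u) u := by
  have h1 : ∀ t : ℝ, 0 < t → b ≤ t → ‖H u‖ ^ 2 ≤ t * inner ℝ (H u) u := by
    intro t ht hbt
    have h2 := hH0 (t • u - H u)
    have h3 := hHb (H u)
    have h4 := hH u (H u)
    rw [← real_inner_self_eq_norm_sq] at h3 ⊢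
    simp only [map_sub, map_smul, inner_sub_left, inner_sub_right, real_inner_smul_left,
      real_inner_smul_right] at h2
    rw [← h4] at h2
    have h5 : b * inner ℝ (H u) (H u) ≤ t * inner ℝ (H u) (H u) :=
      mul_le_mul_of_nonneg_right hbt real_inner_self_nonneg
    have h6 : 0 ≤ t * (t * inner ℝ (H u) u - inner ℝ (H u) (H u)) := by linarith
    linarith [nonneg_of_mul_nonneg_right h6 ht]
  rcases hb.eq_or_lt with rfl | hb
  · have h0 := hHb u
    have h0' := hH0 u
    have h2 := h1 1 one_pos zero_le_one
    rw [show inner ℝ (H u) u = 0 by linarith] at h2 ⊢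
    linarith
  · exact h1 b hb le_rfl

/-- A symmetric form with `τ ‖u‖² ≤ ⟪H u, u⟫` for some `τ > 0` is invertible. -/
lemma isInvertible_of_coercive [FiniteDimensional ℝ E] {H : E →L[ℝ] E} {τ : ℝ} (hτ : 0 < τ)
    (h : ∀ u, τ * ‖u‖ ^ 2 ≤ inner ℝ (H u) u) : H.IsInvertible := by
  have hinj : Function.Injective (H : E →ₗ[ℝ] E) := by
    rw [← LinearMap.ker_eq_bot, LinearMap.ker_eq_bot']
    intro u hu
    have h1 := h u
    have h2 : H u = 0 := hu
    rw [h2, inner_zero_left] at h1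
    have h3 : ‖u‖ ^ 2 ≤ 0 := by
      by_contra hc
      push Not at hc
      nlinarith
    simpa using h3
  exact ⟨(LinearEquiv.ofInjectiveEndo (H : E →ₗ[ℝ] E) hinj).toContinuousLinearEquiv, by
    ext u
    rfl⟩

end Preconditioning

/-! ### Newton steps for the proximal subproblem -/

namespace SoftplusSum

variable {E ι : Type*} [NormedAddCommGroup E] [InnerProductSpace ℝ E] [Fintype ι]
  (P : SoftplusSum E ι)

/-- The gradient at `y` of the proximal objective `P.val y + τ / 2 * ‖y - q‖ ^ 2`. -/
def resid (q : E) (τ : ℝ) (y : E) : E := P.grad y + τ • (y - q)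

/-- One preconditioned gradient step for the proximal objective, where `S` solves linear systems with
the Hessian of the proximal objective at some fixed centre. -/
def newtonStep (S : E → E) (q : E) (τ : ℝ) (y : E) : E := y - (1 / 2 : ℝ) • S (P.resid q τ y)

variable {P} {L₂ L₄ G : ℝ}

/-- The modulus of the quadratic growth of Hessians. -/
def stab (P : SoftplusSum E ι) (L₄ : ℝ) : ℝ := L₄ / (4 * P.μ ^ 3)

/-- A bound for the Hessians. -/
def smooth (P : SoftplusSum E ι) (L₂ : ℝ) : ℝ := L₂ / (4 * P.μ)

lemma Bounded.stab_nonneg (hP : P.Bounded L₂ L₄ G) : 0 ≤ P.stab L₄ := by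
  have := hP.L₄_nonneg
  have := hP.μ_pos
  unfold stab
  positivity

lemma Bounded.smooth_nonneg (hP : P.Bounded L₂ L₄ G) : 0 ≤ P.smooth L₂ := by
  have := hP.L₂_nonneg
  have := hP.μ_pos
  unfold smooth
  positivity

lemma form_add_smul_comm (θ : ι → ℝ) (τ : ℝ) (u z : E) :
    inner ℝ ((P.form θ + τ • ContinuousLinearMap.id ℝ E) u) z
      = inner ℝ ((P.form θ + τ • ContinuousLinearMap.id ℝ E) z) u := by
  simp only [add_apply, smul_apply, ContinuousLinearMap.id_apply, inner_add_left,
    real_inner_smul_left, P.inner_form_comm θ u z, real_inner_comm u z]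

lemma inner_form_add_smul (θ : ι → ℝ) (τ : ℝ) (u : E) :
    inner ℝ ((P.form θ + τ • ContinuousLinearMap.id ℝ E) u) u
      = inner ℝ (P.form θ u) u + τ * ‖u‖ ^ 2 := by
  simp only [add_apply, smul_apply, ContinuousLinearMap.id_apply, inner_add_left,
    real_inner_smul_left, real_inner_self_eq_norm_sq]

lemma Bounded.sigCurv_div_nonneg (hP : P.Bounded L₂ L₄ G) (t : ι → ℝ) (k : ι) :
    0 ≤ sigCurv (t k) / P.μ :=
  div_nonneg (sigCurv_pos _).le hP.μ_pos.le

/-- In a ball whose squared radius is at most `τ / P.stab L₄`, the gradient of the proximal objective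
is an averaged Hessian that agrees with the Hessian at the centre up to a factor two. -/
lemma Bounded.exists_resid_sub_eq (hP : P.Bounded L₂ L₄ G) {q c y z : E} {τ r : ℝ} (hτ : 0 < τ)
    (hr : P.stab L₄ * r ^ 2 ≤ τ) (hy : ‖y - c‖ ≤ r) (hz : ‖z - c‖ ≤ r) :
    ∃ M : E →L[ℝ] E, P.resid q τ y - P.resid q τ z = M (y - z) ∧
      (∀ u z, inner ℝ (M u) z = inner ℝ (M z) u) ∧ (∀ u, 0 ≤ inner ℝ (M u) u) ∧
      (∀ u, inner ℝ ((P.hess c + τ • ContinuousLinearMap.id ℝ E) u) u ≤ 2 * inner ℝ (M u) u) ∧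
      ∀ u, inner ℝ (M u) u ≤ 2 * inner ℝ ((P.hess c + τ • ContinuousLinearMap.id ℝ E) u) u := by
  have hμ := hP.μ_pos
  obtain ⟨t, ht, hmem⟩ := P.exists_grad_sub_eq hμ y z
  have harg : ∀ (x : E) (k : ι), P.μ * (P.arg x k - P.arg c k) = inner ℝ (P.v k) (x - c) := by
    intro x k
    rw [arg, arg, inner_sub_right]
    field_simp
    ring
  have hdist : ∀ k, (P.μ * (t k - P.arg c k)) ^ 2
      ≤ inner ℝ (P.v k) (y - c) ^ 2 + inner ℝ (P.v k) (z - c) ^ 2 := by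
    intro k
    rw [← harg, ← harg]
    have hk := hmem k
    have h0 : (t k - P.arg c k) ^ 2 ≤ (P.arg y k - P.arg c k) ^ 2 + (P.arg z k - P.arg c k) ^ 2 := by
      rcases Set.mem_uIcc.1 hk with ⟨h1, h2⟩ | ⟨h1, h2⟩ <;>
      rcases le_total (t k) (P.arg c k) with h3 | h3 <;>
      nlinarith [sq_nonneg (P.arg y k - P.arg c k), sq_nonneg (P.arg z k - P.arg c k)]
    have h1 := mul_le_mul_of_nonneg_left h0 (sq_nonneg P.μ)
    linarith
  have hdist' : ∀ k, (P.μ * (P.arg c k - t k)) ^ 2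
      ≤ inner ℝ (P.v k) (y - c) ^ 2 + inner ℝ (P.v k) (z - c) ^ 2 := by
    intro k
    have := hdist k
    linarith
  have hle : ∀ u : E, P.stab L₄ * r ^ 2 * ‖u‖ ^ 2 ≤ τ * ‖u‖ ^ 2 := fun u => by gcongr
  have h1 := fun u => hP.form_le_two_mul hy hz hdist u
  have h2 := fun u => hP.form_le_two_mul hy hz hdist' u
  have hpos := fun u => P.inner_form_self_nonneg hP.w_nonneg (hP.sigCurv_div_nonneg t) u
  refine ⟨P.form (fun k => sigCurv (t k) / P.μ) + τ • ContinuousLinearMap.id ℝ E, ?_,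
    form_add_smul_comm _ _, ?_, ?_, ?_⟩
  · rw [add_apply, ← ht, resid, resid, smul_apply, ContinuousLinearMap.id_apply]
    module
  · intro u
    rw [inner_form_add_smul]
    have := hpos u
    positivity
  · intro u
    rw [hess, inner_form_add_smul, inner_form_add_smul]
    have := h2 u
    have := hle u
    unfold stab at *
    linarith
  · intro u
    rw [hess, inner_form_add_smul, inner_form_add_smul]
    have := h1 u
    have := hle u
    unfold stab at *
    linarith

lemma Bounded.norm_form_le (hP : P.Bounded L₂ L₄ G) (t : ι → ℝ) (u : E) :
    ‖P.form (fun k => sigCurv (t k) / P.μ) u‖ ≤ P.smooth L₂ * ‖u‖ := by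
  have hb := hP.smooth_nonneg
  have h1 := norm_sq_apply_le hb (P.inner_form_comm _)
    (P.inner_form_self_nonneg hP.w_nonneg (hP.sigCurv_div_nonneg t)) (hP.form_le t) u
  have h2 := mul_le_mul_of_nonneg_left (hP.form_le t u) hb
  refine abs_le_of_sq_le_sq' ?_ (by positivity) |>.2
  unfold smooth at *
  nlinarith

lemma Bounded.norm_resid_sub_le (hP : P.Bounded L₂ L₄ G) (q : E) {τ : ℝ} (hτ : 0 ≤ τ) (y z : E) :
    ‖P.resid q τ y - P.resid q τ z‖ ≤ (P.smooth L₂ + τ) * ‖y - z‖ := by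
  obtain ⟨t, ht, -⟩ := P.exists_grad_sub_eq hP.μ_pos y z
  have h1 : P.resid q τ y - P.resid q τ z = (P.grad y - P.grad z) + τ • (y - z) := by
    rw [resid, resid]; module
  rw [h1, ht, add_mul]
  refine (norm_add_le _ _).trans (add_le_add (hP.norm_form_le t _) ?_)
  rw [norm_smul, Real.norm_of_nonneg hτ]

/-- Preconditioned gradient steps stay in a ball around the centre that is so small that the
preconditioner remains valid, and the residual decreases geometrically. -/
theorem Bounded.newtonStep_iterate (hP : P.Bounded L₂ L₄ G) {q c : E} {τ e : ℝ} (hτ : 0 < τ)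
    {S : E → E} (hS : ∀ z, (P.hess c + τ • ContinuousLinearMap.id ℝ E) (S z) = z)
    (he : ‖P.resid q τ c‖ ≤ e) (hr : P.stab L₄ * (4 * e / τ) ^ 2 ≤ τ) (n : ℕ) :
    ‖(P.newtonStep S q τ)^[n] c - c‖ ≤ 4 * e / τ ∧
      ‖P.resid q τ ((P.newtonStep S q τ)^[n] c)‖ ^ 2
        ≤ (P.smooth L₂ + τ) / τ * (3 / 4) ^ n * e ^ 2 := by
  have he0 : 0 ≤ e := (norm_nonneg _).trans he
  set H := P.hess c + τ • ContinuousLinearMap.id ℝ E with hHdef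
  set T := P.newtonStep S q τ with hT
  set y : ℕ → E := fun n => T^[n] c with hy
  have hsucc : ∀ n, y (n + 1) = T (y n) := fun n => Function.iterate_succ_apply' T n c
  have hHsym : ∀ u z, inner ℝ (H u) z = inner ℝ (H z) u := form_add_smul_comm _ _
  have hH0 : ∀ u, 0 ≤ inner ℝ (P.hess c u) u :=
    P.inner_form_self_nonneg hP.w_nonneg (hP.sigCurv_div_nonneg (P.arg c))
  have hHin : ∀ u, inner ℝ (H u) u = inner ℝ (P.hess c u) u + τ * ‖u‖ ^ 2 :=
    inner_form_add_smul _ _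
  have hHτ : ∀ u, τ * ‖u‖ ^ 2 ≤ inner ℝ (H u) u := fun u => by
    rw [hHin]
    linarith [hH0 u]
  have hHnn : ∀ u, 0 ≤ inner ℝ (H u) u := fun u => le_trans (by positivity) (hHτ u)
  -- a step contracts distances between points of the ball
  have hcontr : ∀ a b : E, ‖a - c‖ ≤ 4 * e / τ → ‖b - c‖ ≤ 4 * e / τ →
      inner ℝ (H (T a - T b)) (T a - T b) ≤ 3 / 4 * inner ℝ (H (a - b)) (a - b) := by
    intro a b ha hb
    obtain ⟨M, hM, hMsym, hM0, hHM, hMH⟩ := hP.exists_resid_sub_eq (q := q) hτ hr ha hb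
    have h1 : H (S (P.resid q τ a) - S (P.resid q τ b)) = M (a - b) := by
      rw [map_sub, hS, hS, hM]
    have h2 := inner_precond_step_le hHsym hMsym hM0 hHM hMH h1
    have h3 : T a - T b = (a - b) - (1 / 2 : ℝ) • (S (P.resid q τ a) - S (P.resid q τ b)) := by
      rw [hT, newtonStep, newtonStep]
      module
    rw [h3]
    exact h2
  -- the length of the first step
  have hfirst : inner ℝ (H (T c - c)) (T c - c) ≤ e ^ 2 / (4 * τ) := by
    set s := S (P.resid q τ c) with hs
    have h1 : T c - c = -((1 / 2 : ℝ) • s) := by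
      rw [hT, newtonStep]
      abel
    have h2 : inner ℝ (H s) s ≤ e * ‖s‖ := by
      rw [hs, hS]
      exact (real_inner_le_norm _ _).trans (by gcongr)
    have h3 := hHτ s
    rw [h1]
    simp only [map_neg, map_smul, inner_neg_neg, real_inner_smul_left, real_inner_smul_right]
    rw [le_div_iff₀ (by positivity)]
    nlinarith [sq_nonneg (e - τ * ‖s‖), norm_nonneg s]
  have hX : ∀ n, inner ℝ (H (y n - c)) (y n - c) ≤ 14 * e ^ 2 / τ ∧
      ‖y n - c‖ ≤ 4 * e / τ := by
    intro n
    have himp : ∀ a : E, inner ℝ (H (a - c)) (a - c) ≤ 14 * e ^ 2 / τ →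
        ‖a - c‖ ≤ 4 * e / τ := by
      intro a ha
      refine (abs_le_of_sq_le_sq' ?_ (by positivity)).2
      have h1 := (hHτ (a - c)).trans ha
      rw [le_div_iff₀ hτ] at h1
      rw [div_pow, le_div_iff₀ (by positivity)]
      nlinarith [sq_nonneg e]
    suffices h : inner ℝ (H (y n - c)) (y n - c) ≤ 14 * e ^ 2 / τ from ⟨h, himp _ h⟩
    induction n with
    | zero =>
      simp only [hy, Function.iterate_zero, id_eq, sub_self, inner_zero_right]
      positivity
    | succ n ih =>
      have h1 := hcontr (y n) c (himp _ ih) (by rw [sub_self, norm_zero]; positivity)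
      have h2 : y (n + 1) - c = (T (y n) - T c) + (T c - c) := by rw [hsucc]; abel
      have h3 := hHnn ((1 / 6 : ℝ) • (T (y n) - T c) - (T c - c))
      rw [h2]
      have h5 := hHsym (T (y n) - T c) (T c - c)
      generalize T (y n) - T c = a at *
      generalize T c - c = b at *
      simp only [map_sub, map_add, map_smul, inner_add_left, inner_add_right, inner_sub_left,
        inner_sub_right, real_inner_smul_left, real_inner_smul_right] at h3 h5 ⊢
      have h4 : e ^ 2 / (4 * τ) = (1 / 4) * (e ^ 2 / τ) := by field_simp
      rw [h4] at hfirst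
      rw [mul_div_assoc] at ih ⊢
      linarith
  have hδ : ∀ n, inner ℝ (H (y (n + 1) - y n)) (y (n + 1) - y n)
      ≤ (3 / 4) ^ n * (e ^ 2 / (4 * τ)) := by
    intro n
    induction n with
    | zero => simpa [hsucc, hy] using hfirst
    | succ n ih =>
      have h1 := hcontr (y (n + 1)) (y n) (hX _).2 (hX _).2
      rw [← hsucc, ← hsucc] at h1
      rw [pow_succ]
      linarith
  refine ⟨(hX n).2, ?_⟩
  have h1 : P.resid q τ (y n) = -((2 : ℝ) • H (y (n + 1) - y n)) := by
    have h2 : y (n + 1) - y n = -((1 / 2 : ℝ) • S (P.resid q τ (y n))) := by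
      rw [hsucc, hT, newtonStep]
      abel
    rw [h2, map_neg, map_smul, hS]
    module
  have hb : 0 ≤ P.smooth L₂ := hP.smooth_nonneg
  have h3 := norm_sq_apply_le (add_nonneg hb hτ.le) hHsym hHnn (fun u => by
    rw [hHin, add_mul]
    have h4 : inner ℝ (P.hess c u) u ≤ P.smooth L₂ * ‖u‖ ^ 2 := hP.form_le (P.arg c) u
    linarith) (y (n + 1) - y n)
  have h5 := mul_le_mul_of_nonneg_left (hδ n) (add_nonneg hb hτ.le)
  change ‖P.resid q τ (y n)‖ ^ 2 ≤ _
  rw [h1, norm_neg, norm_smul, mul_pow, show ‖(2 : ℝ)‖ ^ 2 = 4 by norm_num]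
  calc 4 * ‖H (y (n + 1) - y n)‖ ^ 2
      ≤ 4 * ((P.smooth L₂ + τ) * ((3 / 4) ^ n * (e ^ 2 / (4 * τ)))) := by linarith
    _ = _ := by
      generalize (3 / 4 : ℝ) ^ n = x
      field_simp

/-- With `n` steps, where `n` is logarithmic in the condition number, the residual becomes a small
fraction of the initial one. -/
lemma Bounded.norm_resid_newtonStep_iterate_le (hP : P.Bounded L₂ L₄ G) {q c : E} {τ e : ℝ}
    (hτ : 0 < τ) {S : E → E} (hS : ∀ z, (P.hess c + τ • ContinuousLinearMap.id ℝ E) (S z) = z)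
    (he : ‖P.resid q τ c‖ ≤ e) (hr : P.stab L₄ * (4 * e / τ) ^ 2 ≤ τ) {n : ℕ}
    (hn : 1024 * ((P.smooth L₂ + τ) / τ) ^ 3 ≤ (4 / 3) ^ n) :
    ‖P.resid q τ ((P.newtonStep S q τ)^[n] c)‖ ≤ e / (32 * ((P.smooth L₂ + τ) / τ)) := by
  have he0 : 0 ≤ e := (norm_nonneg _).trans he
  have hb : 0 ≤ P.smooth L₂ := hP.smooth_nonneg
  have h1 := (hP.newtonStep_iterate hτ hS he hr n).2
  set κ := (P.smooth L₂ + τ) / τ with hκ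
  have hκ0 : 0 < κ := by positivity
  refine (abs_le_of_sq_le_sq' (h1.trans ?_) (by positivity)).2
  have h2 : (3 / 4 : ℝ) ^ n * (4 / 3) ^ n = 1 := by
    rw [← mul_pow]; norm_num
  have h3 : (3 / 4 : ℝ) ^ n * (1024 * κ ^ 3) ≤ 1 := by
    rw [← h2]
    gcongr
  rw [div_pow e, le_div_iff₀ (by positivity)]
  nlinarith [mul_le_mul_of_nonneg_left h3 (sq_nonneg e)]

/-- For large `τ` the proximal subproblem can be solved from the proximal centre. -/
theorem Bounded.resid_start (hP : P.Bounded L₂ L₄ G) {q : E} {τ : ℝ}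
    (hτ : 0 < τ) {S : E → E} (hS : ∀ z, (P.hess q + τ • ContinuousLinearMap.id ℝ E) (S z) = z)
    (hG : 16 * P.stab L₄ * G ^ 2 ≤ τ ^ 3) {n : ℕ}
    (hn : 1024 * ((P.smooth L₂ + τ) / τ) ^ 3 ≤ (4 / 3) ^ n) :
    ‖P.resid q τ ((P.newtonStep S q τ)^[n] q)‖
      ≤ τ / 16 * ‖(P.newtonStep S q τ)^[n] q - q‖ := by
  have hb : 0 ≤ P.smooth L₂ := hP.smooth_nonneg
  have hs := hP.stab_nonneg
  set e := ‖P.resid q τ q‖ with he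
  have heG : e ≤ G := by
    rw [he, resid, sub_self, smul_zero, add_zero]
    exact hP.grad_le q
  have h1 := hP.norm_resid_newtonStep_iterate_le (c := q) (e := e) hτ hS le_rfl (by
    rw [div_pow, mul_pow, mul_div_assoc', div_le_iff₀ (by positivity)]
    have : P.stab L₄ * e ^ 2 ≤ P.stab L₄ * G ^ 2 := by gcongr
    nlinarith) hn
  set y := (P.newtonStep S q τ)^[n] q
  have h2 := hP.norm_resid_sub_le q hτ.le y q
  have h3 : e - ‖P.resid q τ y‖ ≤ ‖P.resid q τ y - P.resid q τ q‖ := by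
    rw [he, norm_sub_rev]
    exact norm_sub_norm_le _ _
  set κ := (P.smooth L₂ + τ) / τ with hκ
  have hκτ : P.smooth L₂ + τ = κ * τ := by rw [hκ]; field_simp
  have hκ1 : 1 ≤ κ := by rw [hκ, le_div_iff₀ hτ]; linarith
  rw [hκτ] at h2
  rw [le_div_iff₀ (by positivity)] at h1
  have h4 : ‖P.resid q τ y‖ ≤ ‖P.resid q τ y‖ * κ := le_mul_of_one_le_right (norm_nonneg _) hκ1
  have h5 : 31 * ‖P.resid q τ y‖ * κ ≤ κ * τ * ‖y - q‖ := by linarith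
  have h6 : 31 * ‖P.resid q τ y‖ ≤ τ * ‖y - q‖ := by
    refine le_of_mul_le_mul_right (a := κ) ?_ (by linarith)
    linarith
  have := norm_nonneg (P.resid q τ y)
  linarith

/-- An approximate solution of the proximal subproblem for `τ` can be turned into one for
`15 / 16 * τ`, as long as the solution is so near to the proximal centre that `τ` dominates the
variation of the Hessian. -/
theorem Bounded.resid_continue (hP : P.Bounded L₂ L₄ G) {q c : E} {τ : ℝ}
    (hτ : 0 < τ) {S : E → E}
    (hS : ∀ z, (P.hess c + (15 / 16 * τ) • ContinuousLinearMap.id ℝ E) (S z) = z)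
    (hc : ‖P.resid q τ c‖ ≤ τ / 16 * ‖c - q‖) (hnear : P.stab L₄ * ‖c - q‖ ^ 2 ≤ τ) {n : ℕ}
    (hn : 1024 * ((P.smooth L₂ + 15 / 16 * τ) / (15 / 16 * τ)) ^ 3 ≤ (4 / 3) ^ n) :
    ‖P.resid q (15 / 16 * τ) ((P.newtonStep S q (15 / 16 * τ))^[n] c)‖
      ≤ 15 / 16 * τ / 16 * ‖(P.newtonStep S q (15 / 16 * τ))^[n] c - q‖ := by
  have hb : 0 ≤ P.smooth L₂ := hP.smooth_nonneg
  have hs := hP.stab_nonneg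
  have hτ' : 0 < 15 / 16 * τ := by positivity
  set D := ‖c - q‖ with hD
  have hD0 : 0 ≤ D := norm_nonneg _
  have he : ‖P.resid q (15 / 16 * τ) c‖ ≤ τ / 8 * D := by
    have h1 : P.resid q (15 / 16 * τ) c = P.resid q τ c - (τ / 16) • (c - q) := by
      rw [resid, resid]; module
    rw [h1]
    refine (norm_sub_le _ _).trans ?_
    rw [norm_smul, Real.norm_of_nonneg (by positivity)]
    linarith
  have hrad : 4 * (τ / 8 * D) / (15 / 16 * τ) = 8 / 15 * D := by
    field_simp
    ring
  have hr : P.stab L₄ * (4 * (τ / 8 * D) / (15 / 16 * τ)) ^ 2 ≤ 15 / 16 * τ := by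
    rw [hrad]
    nlinarith
  have h1 := hP.norm_resid_newtonStep_iterate_le hτ' hS he hr hn
  have h2 := (hP.newtonStep_iterate hτ' hS he hr n).1
  rw [hrad] at h2
  set y := (P.newtonStep S q (15 / 16 * τ))^[n] c
  have h3 : D - ‖y - c‖ ≤ ‖y - q‖ := by
    have : c - q = (y - q) - (y - c) := by abel
    rw [hD, this]
    linarith [norm_sub_le (y - q) (y - c)]
  have h4 : τ / 8 * D / (32 * ((P.smooth L₂ + 15 / 16 * τ) / (15 / 16 * τ))) ≤ τ / 8 * D / 32 := by
    gcongr
    have : 1 ≤ (P.smooth L₂ + 15 / 16 * τ) / (15 / 16 * τ) := by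
      rw [le_div_iff₀ hτ']; linarith
    linarith
  have h5 : 15 / 16 * τ / 16 * (7 / 15 * D) ≤ 15 / 16 * τ / 16 * ‖y - q‖ := by
    gcongr
    linarith
  have : 0 ≤ τ * D := by positivity
  linarith

end SoftplusSum

/-! ### Energy decrease of the accelerated method -/

namespace SoftplusSum

variable {E ι : Type*} [NormedAddCommGroup E] [InnerProductSpace ℝ E] [Fintype ι]
  {P : SoftplusSum E ι} {L₂ L₄ G : ℝ}

/-- One accelerated proximal step. The step aims at the parameter `ℓ` with `ℓ a² = A + a`, while the
proximal subproblem is solved for some `τ ≥ ℓ`; the progress is damped by the factor `γ = ℓ / τ`. The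
energy `A (f x - f u) + ‖v - u‖² / 2` decreases by a multiple of the squared movement. -/
theorem Bounded.energy_le (hP : P.Bounded L₂ L₄ G) {x v y q u x' : E} {A a ℓ τ γ : ℝ}
    (hA : 0 ≤ A) (hγ : γ = ℓ / τ) (hℓ : 0 < ℓ) (hτ : ℓ ≤ τ) (ha : ℓ * a ^ 2 = A + a) (ha0 : 0 < a)
    (hq : (A + a) • q = A • x + a • v)
    (hy : ‖P.resid q τ y‖ ≤ τ / 16 * ‖y - q‖)
    (hx' : (A + γ * a) • x' = ((1 - γ) * A) • x + (γ * (A + a)) • y) :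
    (A + γ * a) * (P.val x' - P.val u) + ‖v - (γ * a) • P.grad y - u‖ ^ 2 / 2
      ≤ A * (P.val x - P.val u) + ‖v - u‖ ^ 2 / 2 - 3 / 8 * ((A + a) * ℓ) * ‖y - q‖ ^ 2 := by
  have hτ0 : 0 < τ := hℓ.trans_le hτ
  have hγ0 : 0 < γ := by rw [hγ]; positivity
  have hγ1 : γ ≤ 1 := by rw [hγ, div_le_one hτ0]; exact hτ
  have hγτ : γ * τ = ℓ := by rw [hγ]; field_simp
  set g := P.grad y with hg
  have conv := P.val_add_inner_le hP.μ_pos hP.w_nonneg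
  -- convexity along the combination defining `x'`
  have hA' : 0 < A + γ * a := by positivity
  have h1 : (A + γ * a) * P.val x' ≤ (1 - γ) * A * P.val x + γ * (A + a) * P.val y := by
    have e1 := mul_le_mul_of_nonneg_left (conv x' x) (mul_nonneg (sub_nonneg.2 hγ1) hA)
    have e2 := mul_le_mul_of_nonneg_left (conv x' y) (show 0 ≤ γ * (A + a) by positivity)
    have e3 : (1 - γ) * A * inner ℝ (P.grad x') (x - x')
        + γ * (A + a) * inner ℝ (P.grad x') (y - x') = 0 := by
      rw [← real_inner_smul_right, ← real_inner_smul_right, ← inner_add_right]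
      have : ((1 - γ) * A) • (x - x') + (γ * (A + a)) • (y - x') = 0 := by
        have : ((1 - γ) * A) • (x - x') + (γ * (A + a)) • (y - x')
          = ((1 - γ) * A) • x + (γ * (A + a)) • y - (A + γ * a) • x' := by module
        rw [this, hx', sub_self]
      rw [this, inner_zero_right]
    linarith
  -- the gradient inequality at `y`, towards `x` and towards `u`
  have h2 : A * (P.val y - P.val x) + a * (P.val y - P.val u)
      ≤ (A + a) * inner ℝ g (y - q) + a * inner ℝ g (v - u) := by
    have e1 := mul_le_mul_of_nonneg_left (conv y x) hA
    have e2 := mul_le_mul_of_nonneg_left (conv y u) ha0.le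
    have e3 : A * inner ℝ g (x - y) + a * inner ℝ g (u - y)
        = -((A + a) * inner ℝ g (y - q) + a * inner ℝ g (v - u)) := by
      simp only [← real_inner_smul_right, ← inner_add_right, ← inner_neg_right]
      congr 1
      have : (A + a) • (y - q) + a • (v - u)
          = (A + a) • y - (A + a) • q + a • (v - u) := by module
      rw [this, hq]
      module
    linarith
  have h3 : ‖v - (γ * a) • g - u‖ ^ 2
      = ‖v - u‖ ^ 2 - 2 * (γ * a) * inner ℝ g (v - u) + (γ * a) ^ 2 * ‖g‖ ^ 2 := by
    have : v - (γ * a) • g - u = (v - u) - (γ * a) • g := by abel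
    rw [this, norm_sub_sq_real, real_inner_smul_right, real_inner_comm, norm_smul, mul_pow,
      Real.norm_eq_abs, sq_abs]
    ring
  -- the condition on the residual, squared
  have h4 : 2 * τ * inner ℝ g (y - q) + ‖g‖ ^ 2 ≤ -(3 / 4 * τ ^ 2 * ‖y - q‖ ^ 2) := by
    have e1 : ‖P.resid q τ y‖ ^ 2 ≤ (τ / 16 * ‖y - q‖) ^ 2 := by gcongr
    have e2 : ‖P.resid q τ y‖ ^ 2 = ‖g‖ ^ 2 + 2 * τ * inner ℝ g (y - q) + τ ^ 2 * ‖y - q‖ ^ 2 := by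
      rw [resid, norm_add_sq_real, real_inner_smul_right, norm_smul, mul_pow, Real.norm_eq_abs,
        sq_abs]
      ring
    have : 0 ≤ τ ^ 2 * ‖y - q‖ ^ 2 := by positivity
    nlinarith
  have h5 : (γ * a) ^ 2 * τ = γ * (A + a) := by
    rw [← ha, ← hγτ]; ring
  have h6 := mul_le_mul_of_nonneg_left h4 (show 0 ≤ (γ * a) ^ 2 by positivity)
  have h7 : (γ * a) ^ 2 * (2 * τ * inner ℝ g (y - q) + ‖g‖ ^ 2)
      = 2 * (γ * (A + a)) * inner ℝ g (y - q) + (γ * a) ^ 2 * ‖g‖ ^ 2 := by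
    rw [← h5]; ring
  have h8 : (γ * a) ^ 2 * -(3 / 4 * τ ^ 2 * ‖y - q‖ ^ 2)
      = -(3 / 4 * ((A + a) * ℓ) * ‖y - q‖ ^ 2) := by
    have : (γ * a) ^ 2 * τ ^ 2 = (A + a) * ℓ := by
      rw [← hγτ]
      linear_combination τ * h5
    linear_combination (-(3 / 4) * ‖y - q‖ ^ 2) * this
  have h9 := mul_le_mul_of_nonneg_left h2 hγ0.le
  rw [h3]
  linarith

end SoftplusSum

/-! ### Programs with oracle calls -/

namespace OracleProg

variable {d : ℕ} {α β : Type}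

/-- Run `p`, then continue with the program that depends on its result. -/
def bind : OracleProg d α → (α → OracleProg d β) → OracleProg d β
  | .done r, f => f r
  | .call q next, f => .call q fun z => bind (next z) f

/-- Run a program `n` times in a row, each time on the previous result. -/
def iter (f : α → OracleProg d α) : ℕ → α → OracleProg d α
  | 0, r => .done r
  | n + 1, r => (iter f n r).bind f

variable (O : Query d → EuclideanSpace ℝ (Fin d))

lemma result_bind (p : OracleProg d α) (f : α → OracleProg d β) :
    (p.bind f).result O = (f (p.result O)).result O := by
  induction p with
  | done r => rfl
  | call q next ih => exact ih (O q)

lemma calls_bind (p : OracleProg d α) (f : α → OracleProg d β) :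
    (p.bind f).calls O = p.calls O + (f (p.result O)).calls O := by
  induction p with
  | done r => simp [bind, calls, result]
  | call q next ih =>
    simp only [bind, calls, result]
    rw [ih]
    omega

lemma result_iter (f : α → OracleProg d α) (n : ℕ) (r : α) :
    (iter f n r).result O = (fun r => (f r).result O)^[n] r := by
  induction n with
  | zero => rfl
  | succ n ih => rw [iter, result_bind, ih, Function.iterate_succ_apply']

lemma calls_iter_le {f : α → OracleProg d α} {K : ℕ} (hf : ∀ r, (f r).calls O ≤ K) (n : ℕ) (r : α) :
    (iter f n r).calls O ≤ n * K := by
  induction n with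
  | zero => simp [iter, calls]
  | succ n ih =>
    rw [iter, calls_bind, add_mul, one_mul]
    exact add_le_add ih (hf _)

end OracleProg

/-! ### The proximal step as a program -/

section Programs

variable {d : ℕ}

/-- One preconditioned gradient step for the proximal subproblem with centre `q`, where the
preconditioner is the Hessian at `c`. -/
def newtonProg (q : EuclideanSpace ℝ (Fin d)) (τ : {t : ℝ // 0 < t})
    (c y : EuclideanSpace ℝ (Fin d)) : OracleProg d (EuclideanSpace ℝ (Fin d)) :=
  .call (.grad y) fun g => .call (.solve c τ (g + τ.1 • (y - q))) fun z =>
    .done (y - (1 / 2 : ℝ) • z)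

/-- Solve the proximal subproblem with `n` steps from `c`. -/
def refineProg (n : ℕ) (q : EuclideanSpace ℝ (Fin d)) (τ : {t : ℝ // 0 < t})
    (c : EuclideanSpace ℝ (Fin d)) : OracleProg d (EuclideanSpace ℝ (Fin d)) :=
  OracleProg.iter (newtonProg q τ c) n c

/-- Pass from a proximal solution for `τ` to one for `15 / 16 * τ`, unless the solution has already
moved so far from `q` that `τ < Λ * ‖y - q‖ ^ 2`. -/
def pathStep (Λ : ℝ) (n : ℕ) (q : EuclideanSpace ℝ (Fin d))
    (s : EuclideanSpace ℝ (Fin d) × {t : ℝ // 0 < t}) :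
    OracleProg d (EuclideanSpace ℝ (Fin d) × {t : ℝ // 0 < t}) :=
  open Classical in
  if Λ * ‖s.1 - q‖ ^ 2 ≤ s.2.1 then
    (refineProg n q ⟨15 / 16 * s.2.1, mul_pos (by norm_num) s.2.2⟩ s.1).bind fun y =>
      .done (y, ⟨15 / 16 * s.2.1, mul_pos (by norm_num) s.2.2⟩)
  else .done s

/-- Follow the path of proximal solutions for decreasing `τ`, down to `τ = ℓ` at the earliest. -/
def proxProg (Λ : ℝ) (n J : ℕ) (q : EuclideanSpace ℝ (Fin d)) (ℓ : {t : ℝ // 0 < t}) :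
    OracleProg d (EuclideanSpace ℝ (Fin d) × {t : ℝ // 0 < t}) :=
  (refineProg n q ⟨ℓ.1 * (16 / 15) ^ J, mul_pos ℓ.2 (by positivity)⟩ q).bind fun y =>
    OracleProg.iter (pathStep Λ n q) J (y, ⟨ℓ.1 * (16 / 15) ^ J, mul_pos ℓ.2 (by positivity)⟩)

variable {ι : Type*} [Fintype ι]

/-- The oracle `O` answers correctly for the function given by `P`. -/
structure IsOracleFor (O : Query d → EuclideanSpace ℝ (Fin d))
    (P : SoftplusSum (EuclideanSpace ℝ (Fin d)) ι) : Prop where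
  grad : ∀ x, O (.grad x) = P.grad x
  solve : ∀ x τ z,
    (P.hess x + τ.1 • ContinuousLinearMap.id ℝ (EuclideanSpace ℝ (Fin d))) (O (.solve x τ z)) = z

variable {O : Query d → EuclideanSpace ℝ (Fin d)}
  {P : SoftplusSum (EuclideanSpace ℝ (Fin d)) ι} {L₂ L₄ G : ℝ}

lemma IsOracleFor.result_refineProg (hO : IsOracleFor O P) (n : ℕ) (q c : EuclideanSpace ℝ (Fin d))
    (τ : {t : ℝ // 0 < t}) :
    (refineProg n q τ c).result O = (P.newtonStep (fun z => O (.solve c τ z)) q τ)^[n] c := by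
  rw [refineProg, OracleProg.result_iter]
  congr 1
  funext y
  simp only [newtonProg, OracleProg.result, SoftplusSum.newtonStep, SoftplusSum.resid, hO.grad]

lemma calls_refineProg_le (n : ℕ) (q c : EuclideanSpace ℝ (Fin d)) (τ : {t : ℝ // 0 < t}) :
    (refineProg n q τ c).calls O ≤ n * 2 :=
  OracleProg.calls_iter_le O (fun r => (le_rfl : (newtonProg q τ c r).calls O ≤ 2)) n c

lemma calls_proxProg_le (Λ : ℝ) (n J : ℕ) (q : EuclideanSpace ℝ (Fin d)) (ℓ : {t : ℝ // 0 < t}) :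
    (proxProg Λ n J q ℓ).calls O ≤ n * 2 + J * (n * 2) := by
  rw [proxProg, OracleProg.calls_bind]
  refine add_le_add (calls_refineProg_le _ _ _ _) (OracleProg.calls_iter_le O (fun s => ?_) _ _)
  unfold pathStep
  split_ifs
  · rw [OracleProg.calls_bind]
    exact calls_refineProg_le _ _ _ _
  · exact Nat.zero_le _

/-- The proximal program returns an approximate proximal solution for some `τ ≥ ℓ`, and `τ` can only
exceed `ℓ` if the solution is far from the proximal centre. -/
theorem SoftplusSum.Bounded.result_proxProg (hP : P.Bounded L₂ L₄ G) (hO : IsOracleFor O P)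
    {n J : ℕ} {q : EuclideanSpace ℝ (Fin d)} {ℓ : {t : ℝ // 0 < t}}
    (hn : 1024 * ((P.smooth L₂ + ℓ.1) / ℓ.1) ^ 3 ≤ (4 / 3) ^ n)
    (hJ : 16 * P.stab L₄ * G ^ 2 ≤ (ℓ.1 * (16 / 15) ^ J) ^ 3)
    {y : EuclideanSpace ℝ (Fin d)} {τ : {t : ℝ // 0 < t}} (h : (proxProg (P.stab L₄) n J q ℓ).result O = (y, τ)) :
    ℓ.1 ≤ τ.1 ∧ ‖P.resid q τ y‖ ≤ τ / 16 * ‖y - q‖ ∧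
      (τ.1 = ℓ.1 ∨ τ.1 < P.stab L₄ * ‖y - q‖ ^ 2) := by
  have hb := hP.smooth_nonneg
  have hn' : ∀ τ : ℝ, ℓ.1 ≤ τ → 1024 * ((P.smooth L₂ + τ) / τ) ^ 3 ≤ (4 / 3 : ℝ) ^ n := by
    intro τ hτ
    have hℓ := ℓ.2
    have hτ0 : 0 < τ := hℓ.trans_le hτ
    refine le_trans ?_ hn
    gcongr 1024 * ?_ ^ 3
    rw [div_le_div_iff₀ hτ0 hℓ]
    nlinarith
  have hpow : ∀ i : ℕ, (1 : ℝ) ≤ (16 / 15) ^ i := fun i => one_le_pow₀ (by norm_num)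
  rw [proxProg, OracleProg.result_bind, OracleProg.result_iter, hO.result_refineProg] at h
  set τ₀ : {t : ℝ // 0 < t} := ⟨ℓ.1 * (16 / 15) ^ J, mul_pos ℓ.2 (by positivity)⟩ with hτ₀
  set s₀ : EuclideanSpace ℝ (Fin d) × {t : ℝ // 0 < t} :=
    ((P.newtonStep (fun z => O (.solve q τ₀ z)) q τ₀)^[n] q, τ₀) with hs₀
  set T := fun s => (pathStep (P.stab L₄) n q s).result O with hT
  suffices hinv : ∀ i ≤ J, ℓ.1 ≤ (T^[i] s₀).2.1 ∧
      ‖P.resid q (T^[i] s₀).2.1 (T^[i] s₀).1‖ ≤ (T^[i] s₀).2.1 / 16 * ‖(T^[i] s₀).1 - q‖ ∧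
      ((T^[i] s₀).2.1 = ℓ.1 * (16 / 15) ^ (J - i) ∨
        (T^[i] s₀).2.1 < P.stab L₄ * ‖(T^[i] s₀).1 - q‖ ^ 2) by
    have := hinv J le_rfl
    rw [h] at this
    simpa using this
  intro i
  induction i with
  | zero =>
    intro _
    have hle : ℓ.1 ≤ τ₀.1 := le_mul_of_one_le_right ℓ.2.le (hpow J)
    exact ⟨hle, hP.resid_start τ₀.2 (fun z => hO.solve q τ₀ z) hJ (hn' _ hle), Or.inl rfl⟩
  | succ i ih =>
    intro hi
    obtain ⟨h1, h2, h3⟩ := ih (by omega)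
    rw [Function.iterate_succ_apply']
    generalize T^[i] s₀ = s at h1 h2 h3 ⊢
    by_cases hc : P.stab L₄ * ‖s.1 - q‖ ^ 2 ≤ s.2.1
    · have h4 := h3.resolve_right (not_lt.2 hc)
      have h5 : 15 / 16 * s.2.1 = ℓ.1 * (16 / 15) ^ (J - (i + 1)) := by
        rw [h4, show J - i = J - (i + 1) + 1 by omega, pow_succ]
        ring
      have h6 : ℓ.1 ≤ 15 / 16 * s.2.1 := by
        rw [h5]
        exact le_mul_of_one_le_right ℓ.2.le (hpow _)
      have h7 : T s = ((P.newtonStep (fun z => O (.solve s.1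
          ⟨15 / 16 * s.2.1, mul_pos (by norm_num) s.2.2⟩ z)) q (15 / 16 * s.2.1))^[n] s.1,
          ⟨15 / 16 * s.2.1, mul_pos (by norm_num) s.2.2⟩) := by
        simp only [hT, pathStep, if_pos hc, OracleProg.result_bind, hO.result_refineProg]
        rfl
      rw [h7]
      exact ⟨h6, hP.resid_continue s.2.2 (fun z => hO.solve s.1 _ z) h2 hc (hn' _ h6), Or.inl h5⟩
    · have h7 : T s = s := by
        simp only [hT, pathStep, if_neg hc]
        rfl
      rw [h7]
      exact ⟨h1, h2, Or.inr (not_le.1 hc)⟩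

end Programs

/-! ### The accelerated method -/

/-- The memory of the accelerated method: the current point `x`, the dual point `v`, and the weight
`A` that the current point has accumulated. -/
structure AccelState (d : ℕ) : Type where
  x : EuclideanSpace ℝ (Fin d)
  v : EuclideanSpace ℝ (Fin d)
  A : ℝ

/-- The constants of the accelerated method. -/
structure AccelParams : Type where
  /-- the modulus that limits the movement in the proximal steps -/
  Λ : ℝ
  /-- the number of preconditioned gradient steps for a proximal subproblem -/
  n : ℕ
  /-- the length of the path of proximal subproblems -/
  J : ℕ
  /-- the scale of the weights: `k` undamped iterations lead at least to the weight `scale * k ^ 5` -/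
  scale : ℝ
  /-- the weight at which the method stops -/
  target : ℝ

/-- Regard a real number as positive; the value at non-positive numbers is irrelevant. -/
def asPos (t : ℝ) : {t : ℝ // 0 < t} :=
  open Classical in if h : 0 < t then ⟨t, h⟩ else ⟨1, one_pos⟩

lemma asPos_val {t : ℝ} (h : 0 < t) : (asPos t).1 = t := by
  rw [asPos, dif_pos h]

namespace AccelParams

variable (c : AccelParams)

/-- The number of undamped iterations to which a weight `A` corresponds: `A = scale * level A ^ 5`. -/
def level (A : ℝ) : ℝ := (A / c.scale) ^ (1 / 5 : ℝ)

/-- The increment of the weight in an undamped iteration, which raises the level by one. -/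
def incr (A : ℝ) : ℝ := c.scale * (c.level A + 1) ^ 5 - A

/-- The proximal parameter `ℓ` that satisfies `ℓ * incr ^ 2 = A + incr`. -/
def prox (A : ℝ) : ℝ := (A + c.incr A) / c.incr A ^ 2

variable {d : ℕ}

/-- The centre of the proximal subproblem. -/
def centre (s : AccelState d) : EuclideanSpace ℝ (Fin d) :=
  (1 / (s.A + c.incr s.A)) • (s.A • s.x + c.incr s.A • s.v)

/-- The new state, given the solution `y` of the proximal subproblem for `τ`, and the gradient `g`
at `y`. -/
def update (s : AccelState d) (y : EuclideanSpace ℝ (Fin d)) (τ : ℝ)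
    (g : EuclideanSpace ℝ (Fin d)) : AccelState d where
  x := (1 / (s.A + c.prox s.A / τ * c.incr s.A)) •
    (((1 - c.prox s.A / τ) * s.A) • s.x + (c.prox s.A / τ * (s.A + c.incr s.A)) • y)
  v := s.v - (c.prox s.A / τ * c.incr s.A) • g
  A := s.A + c.prox s.A / τ * c.incr s.A

/-- One iteration of the accelerated method. -/
def step (s : AccelState d) : OracleProg d (AccelState d) :=
  open Classical in
  if c.target ≤ s.A then .done s
  else (proxProg c.Λ c.n c.J (c.centre s) (asPos (c.prox s.A))).bind fun z =>
    .call (.grad z.1) fun g => .done (c.update s z.1 z.2.1 g)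

/-- The accelerated method. -/
def method (d : ℕ) : IterMethod d where
  State := AccelState d
  init x := ⟨x, x, 0⟩
  step := c.step
  point := AccelState.x
  point_init _ := rfl

lemma calls_step_le (O : Query d → EuclideanSpace ℝ (Fin d)) (s : AccelState d) :
    (c.step s).calls O ≤ c.n * 2 + c.J * (c.n * 2) + 1 := by
  unfold step
  split_ifs
  · exact Nat.zero_le _
  · rw [OracleProg.calls_bind]
    exact add_le_add (calls_proxProg_le _ _ _ _ _) le_rfl

variable {c}

lemma level_nonneg (hS : 0 < c.scale) {A : ℝ} (hA : 0 ≤ A) : 0 ≤ c.level A :=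
  Real.rpow_nonneg (div_nonneg hA hS.le) _

lemma scale_mul_level_pow (hS : 0 < c.scale) {A : ℝ} (hA : 0 ≤ A) :
    c.scale * c.level A ^ 5 = A := by
  rw [level, ← Real.rpow_natCast, ← Real.rpow_mul (div_nonneg hA hS.le)]
  norm_num
  field_simp

lemma level_mono (hS : 0 < c.scale) {A B : ℝ} (hA : 0 ≤ A) (hAB : A ≤ B) :
    c.level A ≤ c.level B := by
  unfold level
  gcongr

lemma level_scale_mul_pow (hS : 0 < c.scale) {k : ℝ} (hk : 0 ≤ k) :
    c.level (c.scale * k ^ 5) = k := by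
  rw [level, mul_div_cancel_left₀ _ hS.ne', ← Real.rpow_natCast, ← Real.rpow_mul hk]
  norm_num

/-- The numerical relations between the constants under which the method converges: `κ` is the level
of the target, `ℓ₀` is a lower bound for the proximal parameters, `β` a bound for the Hessians and
`G` for the gradients, and `B` bounds the energy lost in a damped iteration from below. -/
structure Good (c : AccelParams) (β G κ ℓ₀ B : ℝ) : Prop where
  scale_pos : 0 < c.scale
  κ_pos : 0 < κ
  target_eq : c.target = c.scale * κ ^ 5
  ℓ₀_pos : 0 < ℓ₀
  ℓ₀_le : ℓ₀ * (c.scale * (κ + 1) ^ 5) ≤ 1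
  n_le : 1024 * ((β + ℓ₀) / ℓ₀) ^ 3 ≤ (4 / 3) ^ c.n
  J_le : 16 * c.Λ * G ^ 2 ≤ (ℓ₀ * (16 / 15) ^ c.J) ^ 3
  B_nonneg : 0 ≤ B
  B_le : B * (c.Λ * (625 * (c.scale * (κ + 1)))) ≤ 3 / 8

variable {β G κ ℓ₀ B : ℝ}

lemma Good.incr_bounds (hc : c.Good β G κ ℓ₀ B) {A : ℝ} (hA : 0 ≤ A) :
    0 < c.incr A ∧ c.incr A ≤ 5 * c.scale * (c.level A + 1) ^ 4 := by
  have hS := hc.scale_pos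
  have hk := level_nonneg hS hA
  have hAk := scale_mul_level_pow hS hA
  unfold incr
  set k := c.level A
  have h1 : c.scale * (k + 1) ^ 5 - A = c.scale * ((k + 1) ^ 5 - k ^ 5) := by
    rw [← hAk]; ring
  rw [h1]
  constructor
  · have : k ^ 5 < (k + 1) ^ 5 := by gcongr; linarith
    exact mul_pos hS (by linarith)
  · rw [mul_comm 5, mul_assoc]
    refine mul_le_mul_of_nonneg_left ?_ hS.le
    have : 0 ≤ 10 * k ^ 3 + 20 * k ^ 2 + 15 * k + 4 := by positivity
    nlinarith

lemma add_incr (A : ℝ) : A + c.incr A = c.scale * (c.level A + 1) ^ 5 := by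
  unfold incr; ring

lemma Good.level_lt (hc : c.Good β G κ ℓ₀ B) {A : ℝ} (hA : 0 ≤ A) (hAt : A < c.target) :
    c.level A < κ := by
  by_contra h
  push Not at h
  have := scale_mul_level_pow hc.scale_pos hA
  rw [hc.target_eq, ← this] at hAt
  have h2 : κ ^ 5 ≤ c.level A ^ 5 := by
    have := hc.κ_pos
    gcongr
  have := mul_le_mul_of_nonneg_left h2 hc.scale_pos.le
  linarith

lemma Good.le_prox (hc : c.Good β G κ ℓ₀ B) {A : ℝ} (hA : 0 ≤ A) (hAt : A < c.target) :
    ℓ₀ ≤ c.prox A := by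
  have hS := hc.scale_pos
  have hk := level_nonneg hS hA
  have hlt := hc.level_lt hA hAt
  obtain ⟨h1, -⟩ := hc.incr_bounds hA
  have h2 := add_incr (c := c) A
  have hℓ := hc.ℓ₀_pos
  rw [prox, le_div_iff₀ (by positivity)]
  have h3 : c.incr A ≤ A + c.incr A := by linarith
  have h4 : A + c.incr A ≤ c.scale * (κ + 1) ^ 5 := by
    rw [h2]; gcongr
  have h5 := hc.ℓ₀_le
  calc ℓ₀ * c.incr A ^ 2 ≤ ℓ₀ * ((A + c.incr A) * (c.scale * (κ + 1) ^ 5)) := by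
        rw [sq]
        gcongr
        exact h3.trans h4
    _ = (A + c.incr A) * (ℓ₀ * (c.scale * (κ + 1) ^ 5)) := by ring
    _ ≤ (A + c.incr A) * 1 := by gcongr
    _ = _ := mul_one _

lemma Good.prox_mul_sq (hc : c.Good β G κ ℓ₀ B) {A : ℝ} (hA : 0 ≤ A) :
    c.prox A * c.incr A ^ 2 = A + c.incr A := by
  have := (hc.incr_bounds hA).1
  rw [prox, div_mul_cancel₀ _ (by positivity)]

/-- A damped iteration moves by more than `√(ℓ / Λ)`, which costs at least the energy `B`. -/
lemma Good.le_energy_drop (hc : c.Good β G κ ℓ₀ B) {A D : ℝ} (hA : 0 ≤ A) (hAt : A < c.target)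
    (hΛ : 0 ≤ c.Λ) (hD : c.prox A < c.Λ * D ^ 2) :
    B ≤ 3 / 8 * ((A + c.incr A) * c.prox A) * D ^ 2 := by
  have hS := hc.scale_pos
  have hk := level_nonneg hS hA
  have hlt := hc.level_lt hA hAt
  obtain ⟨h1, h2⟩ := hc.incr_bounds hA
  have hp : 0 < c.prox A := hc.ℓ₀_pos.trans_le (hc.le_prox hA hAt)
  have h3 := add_incr (c := c) A
  have hΛ' : 0 < c.Λ := by
    rcases hΛ.eq_or_lt with h | h
    · rw [← h, zero_mul] at hD
      linarith
    · exact h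
  have hB := hc.B_le
  set k := c.level A
  set a := c.incr A
  set S := c.scale
  have h4 : 1 ≤ (A + a) * c.prox A ^ 2 * (625 * (S * (k + 1))) := by
    have h5 : (A + a) * c.prox A ^ 2 = (A + a) ^ 3 / a ^ 4 := by
      rw [show c.prox A = (A + a) / a ^ 2 from rfl]
      field_simp
    have h6 : a ^ 4 ≤ (5 * S * (k + 1) ^ 4) ^ 4 := by gcongr
    rw [h5, div_mul_eq_mul_div, le_div_iff₀ (by positivity), one_mul, h3]
    refine h6.trans (le_of_eq ?_)
    ring
  have h7 : 1 ≤ (A + a) * c.prox A ^ 2 * (625 * (S * (κ + 1))) := by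
    refine h4.trans ?_
    have : 0 ≤ A + a := by linarith
    gcongr
  set W := 625 * (S * (κ + 1)) with hW
  have hκ := hc.κ_pos
  have hW0 : 0 < W := by positivity
  have hAa : 0 < A + a := by linarith
  have h8 : (A + a) * c.prox A * c.prox A ≤ (A + a) * c.prox A * (c.Λ * D ^ 2) := by gcongr
  have h9 : 1 ≤ (A + a) * c.prox A * (c.Λ * D ^ 2) * W := by
    refine h7.trans (mul_le_mul_of_nonneg_right ?_ hW0.le)
    linarith
  have h10 : B * (c.Λ * W) ≤ 3 / 8 * ((A + a) * c.prox A) * D ^ 2 * (c.Λ * W) := by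
    linarith
  exact le_of_mul_le_mul_right h10 (by positivity)

variable {ι : Type*} [Fintype ι] {O : Query d → EuclideanSpace ℝ (Fin d)}
  {P : SoftplusSum (EuclideanSpace ℝ (Fin d)) ι} {L₂ L₄ : ℝ}

/-- The energy of a state, relative to the comparison point `u`. -/
def energy (P : SoftplusSum (EuclideanSpace ℝ (Fin d)) ι) (u : EuclideanSpace ℝ (Fin d))
    (s : AccelState d) : ℝ :=
  s.A * (P.val s.x - P.val u) + ‖s.v - u‖ ^ 2 / 2

/-- Before the target is reached, every iteration keeps the energy from growing, and it lowers the
energy minus `B` times the level by at least `B`: an undamped iteration gains a level, a damped one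
loses energy. -/
theorem Good.step_result (hc : c.Good (P.smooth L₂) G κ ℓ₀ B) (hP : P.Bounded L₂ L₄ G)
    (hO : IsOracleFor O P) (hΛ : c.Λ = P.stab L₄) (u : EuclideanSpace ℝ (Fin d))
    {s s' : AccelState d} (hA : 0 ≤ s.A) (hAt : s.A < c.target) (hs' : s' = (c.step s).result O) :
    0 ≤ s'.A ∧ energy P u s' ≤ energy P u s ∧
      energy P u s' - B * c.level s'.A ≤ energy P u s - B * c.level s.A - B := by
  have hS := hc.scale_pos
  have hΛ0 : 0 ≤ c.Λ := by rw [hΛ]; exact hP.stab_nonneg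
  have hb := hP.smooth_nonneg
  have hℓ₀ := hc.ℓ₀_pos
  have hle := hc.le_prox hA hAt
  have hp : 0 < c.prox s.A := hℓ₀.trans_le hle
  obtain ⟨ha, -⟩ := hc.incr_bounds hA
  rw [step, if_neg (not_le.2 hAt), OracleProg.result_bind] at hs'
  obtain ⟨y, τ, hz⟩ : ∃ y τ, (proxProg c.Λ c.n c.J (c.centre s) (asPos (c.prox s.A))).result O
      = (y, τ) := ⟨_, _, rfl⟩
  rw [hz] at hs'
  simp only [OracleProg.result, hO.grad] at hs'
  rw [hΛ] at hz
  have hres := hP.result_proxProg hO (by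
    rw [asPos_val hp]
    refine le_trans ?_ hc.n_le
    gcongr 1024 * ?_ ^ 3
    rw [div_le_div_iff₀ hp hℓ₀]
    nlinarith) (by
    rw [asPos_val hp, ← hΛ]
    refine hc.J_le.trans ?_
    gcongr) hz
  rw [asPos_val hp, ← hΛ] at hres
  obtain ⟨hτ, hr, hcase⟩ := hres
  have hτ0 := τ.2
  have hγ0 : 0 < c.prox s.A / τ := by positivity
  have hA' : 0 < s.A + c.prox s.A / τ * c.incr s.A := by positivity
  have hen := hP.energy_le (x := s.x) (v := s.v) (y := y) (q := c.centre s) (u := u) (x' := s'.x)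
    hA rfl hp hτ (hc.prox_mul_sq hA) ha (by
      rw [centre, smul_smul, mul_one_div_cancel (by positivity), one_smul]) hr (by
      rw [hs', update, smul_smul, mul_one_div_cancel hA'.ne', one_smul])
  have hsA : s'.A = s.A + c.prox s.A / τ * c.incr s.A := by rw [hs', update]
  have hsv : s'.v = s.v - (c.prox s.A / τ * c.incr s.A) • P.grad y := by rw [hs', update]
  rw [← hsA, ← hsv] at hen
  set drop := 3 / 8 * ((s.A + c.incr s.A) * c.prox s.A) * ‖y - c.centre s‖ ^ 2 with hdrop
  have hdrop0 : 0 ≤ drop := by positivity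
  have hen' : energy P u s' ≤ energy P u s - drop := hen
  refine ⟨by rw [hsA]; exact hA'.le, by linarith, ?_⟩
  rcases hcase with h | h
  · -- undamped iteration
    have h1 : s'.A = c.scale * (c.level s.A + 1) ^ 5 := by
      rw [hsA, h, div_self hp.ne', one_mul, add_incr]
    have h2 : c.level s'.A = c.level s.A + 1 := by
      rw [h1, level_scale_mul_pow hS (by linarith [level_nonneg hS hA])]
    rw [h2]
    linarith
  · -- damped iteration
    have h1 : c.level s.A ≤ c.level s'.A := level_mono hS hA (by
      rw [hsA]
      have : 0 ≤ c.prox s.A / τ * c.incr s.A := by positivity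
      linarith)
    have h2 := hc.le_energy_drop hA hAt hΛ0 (hτ.trans_lt h)
    have h3 := mul_le_mul_of_nonneg_left h1 hc.B_nonneg
    linarith

/-- The method reaches its target within `N` iterations if its number of undamped iterations, at most
`κ`, and its number of damped iterations, bounded through the energy, add up to less than `N`. The
energy may be negative, as the comparison point `u` need not be a minimizer. -/
theorem Good.val_iterate_sub_le (hc : c.Good (P.smooth L₂) G κ ℓ₀ B) (hP : P.Bounded L₂ L₄ G)
    (hO : IsOracleFor O P) (hΛ : c.Λ = P.stab L₄) {u x₀ : EuclideanSpace ℝ (Fin d)} {δ R : ℝ}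
    (hδ : ∀ x, -δ ≤ P.val x - P.val u) (hδ0 : 0 ≤ δ) (hR : ‖x₀ - u‖ ≤ R) {N : ℕ}
    (hN : R ^ 2 / 2 + c.target * δ < B * (N - κ)) :
    P.val ((c.method d).iterate O x₀ N) - P.val u ≤ R ^ 2 / (2 * c.target) := by
  have hR0 : 0 ≤ R := (norm_nonneg _).trans hR
  have hS := hc.scale_pos
  have htpos : 0 < c.target := by
    rw [hc.target_eq]
    have := hc.κ_pos
    positivity
  let st : ℕ → AccelState d := (c.method d).stateAt O x₀
  have hsucc : ∀ t, st (t + 1) = (c.step (st t)).result O := fun _ => rfl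
  have hinv : ∀ t, 0 ≤ (st t).A ∧ energy P u (st t) ≤ R ^ 2 / 2 ∧
      ((st t).A < c.target →
        energy P u (st t) ≤ R ^ 2 / 2 + B * (c.level (st t).A - t)) := by
    intro t
    induction t with
    | zero =>
      have h0 : st 0 = ⟨x₀, x₀, 0⟩ := rfl
      have hE : energy P u (st 0) ≤ R ^ 2 / 2 := by
        rw [h0, energy]
        have : ‖x₀ - u‖ ^ 2 ≤ R ^ 2 := by gcongr
        simp only [zero_mul, zero_add]
        linarith
      refine ⟨by rw [h0], hE, fun _ => hE.trans ?_⟩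
      have h1 := level_nonneg (c := c) hS (A := (st 0).A) (by rw [h0])
      have := mul_nonneg hc.B_nonneg h1
      simpa using this
    | succ t ih =>
      obtain ⟨h1, h2, h3⟩ := ih
      by_cases hA : (st t).A < c.target
      · obtain ⟨g1, g2, g3⟩ := hc.step_result hP hO hΛ u h1 hA (hsucc t)
        refine ⟨g1, g2.trans h2, fun _ => ?_⟩
        have := h3 hA
        push_cast
        linarith
      · have h4 : st (t + 1) = st t := by
          rw [hsucc, step, if_pos (not_lt.1 hA)]
          rfl
        rw [h4]
        exact ⟨h1, h2, fun h => absurd h hA⟩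
  obtain ⟨h1, h2, h3⟩ := hinv N
  have h4 : c.target ≤ (st N).A := by
    by_contra hA
    push Not at hA
    have h5 := h3 hA
    have h6 := hc.level_lt h1 hA
    have h7 : -(c.target * δ) ≤ energy P u (st N) := by
      have g1 := mul_le_mul_of_nonneg_left (hδ (st N).x) h1
      have g2 := mul_le_mul_of_nonneg_right hA.le hδ0
      have g3 : 0 ≤ ‖(st N).v - u‖ ^ 2 / 2 := by positivity
      unfold energy
      linarith
    have h8 := mul_le_mul_of_nonneg_left h6.le hc.B_nonneg
    linarith
  change P.val (st N).x - P.val u ≤ _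
  rcases le_or_gt (P.val (st N).x - P.val u) 0 with h | h
  · exact h.trans (by positivity)
  · rw [le_div_iff₀ (by positivity)]
    have g3 : 0 ≤ ‖(st N).v - u‖ ^ 2 / 2 := by positivity
    have g4 := mul_le_mul_of_nonneg_right h4 h.le
    unfold energy at h2
    linarith

end AccelParams

/-! ### The smoothed objective as a sum of softplus ridge functions -/

section Objective

lemma smax_pair (μ s t : ℝ) :
    smax μ ![s, t] = μ * Real.log (Real.exp (s / μ) + Real.exp (t / μ)) := by
  simp [smax, Fin.sum_univ_two]

lemma max_le_smax {μ : ℝ} (hμ : 0 < μ) (s t : ℝ) : max s t ≤ smax μ ![s, t] := by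
  rw [smax_pair]
  have h : ∀ r : ℝ, Real.exp (r / μ) ≤ Real.exp (s / μ) + Real.exp (t / μ) →
      r ≤ μ * Real.log (Real.exp (s / μ) + Real.exp (t / μ)) := by
    intro r hr
    have := (Real.le_log_iff_exp_le (by positivity)).2 hr
    rw [div_le_iff₀ hμ] at this
    linarith
  refine max_le (h s ?_) (h t ?_)
  · linarith [Real.exp_pos (t / μ)]
  · linarith [Real.exp_pos (s / μ)]

lemma smax_le_max_add {μ : ℝ} (hμ : 0 < μ) (s t : ℝ) : smax μ ![s, t] ≤ max s t + μ * Real.log 2 := by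
  rw [smax_pair]
  have h : Real.exp (s / μ) + Real.exp (t / μ) ≤ 2 * Real.exp (max s t / μ) := by
    have h1 : Real.exp (s / μ) ≤ Real.exp (max s t / μ) := by gcongr; exact le_max_left _ _
    have h2 : Real.exp (t / μ) ≤ Real.exp (max s t / μ) := by gcongr; exact le_max_right _ _
    linarith
  have h3 := Real.log_le_log (by positivity) h
  rw [Real.log_mul (by norm_num) (Real.exp_pos _).ne', Real.log_exp] at h3
  have h4 := mul_le_mul_of_nonneg_left h3 hμ.le
  rw [mul_add, mul_div_cancel₀ _ hμ.ne'] at h4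
  linarith

variable {d m : ℕ} (lam : ℝ) (a : Fin m → EuclideanSpace ℝ (Fin d)) (b : Fin m → ℝ) (μ : ℝ)

/-- The smoothed objective in terms of softplus functions. The smooth absolute value is
`-t + μ * log (1 + exp (2 * t / μ))`, so that a coordinate `j` contributes to the linear part and
gives a ridge function in the direction `2 eⱼ`. -/
def svmSum : SoftplusSum (EuclideanSpace ℝ (Fin d)) (Fin d ⊕ Fin m) where
  lin := ∑ j, (-lam) • EuclideanSpace.single j (1 : ℝ)
  w := Sum.elim (fun _ => lam) fun _ => 1 / m
  v := Sum.elim (fun j => (2 : ℝ) • EuclideanSpace.single j (1 : ℝ)) fun i => -(b i • a i)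
  c := Sum.elim (fun _ => 0) fun _ => 1
  μ := μ

lemma dataMatrix_mulVec (x : EuclideanSpace ℝ (Fin d)) (i : Fin m) :
    (dataMatrix a b *ᵥ fun j => x j) i = b i * inner ℝ (a i) x := by
  simp only [Matrix.mulVec, dotProduct, dataMatrix, Matrix.of_apply, PiLp.inner_apply,
    RCLike.inner_apply, conj_trivial, Finset.mul_sum]
  exact Finset.sum_congr rfl fun j _ => by ring

lemma inner_single_one (j : Fin d) (x : EuclideanSpace ℝ (Fin d)) :
    inner ℝ (EuclideanSpace.single j (1 : ℝ)) x = x j := by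
  rw [EuclideanSpace.inner_single_left, map_one, one_mul]

lemma smoothed_eq_val (hμ : 0 < μ) : smoothed lam a b μ = (svmSum lam a b μ).val := by
  funext x
  have h1 : ∀ t : ℝ, sabs μ t = -t + μ * Real.log (1 + Real.exp (2 * t / μ)) := by
    intro t
    rw [sabs, smax_pair]
    have : Real.exp (t / μ) + Real.exp (-t / μ)
        = Real.exp (-t / μ) * (1 + Real.exp (2 * t / μ)) := by
      rw [mul_add, mul_one, ← Real.exp_add, add_comm]
      congr 2
      ring
    rw [this, Real.log_mul (Real.exp_pos _).ne' (by positivity), Real.log_exp, mul_add,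
      mul_div_cancel₀ _ hμ.ne']
  have h2 : ∀ t : ℝ, shinge μ t = μ * Real.log (1 + Real.exp (t / μ)) := by
    intro t
    rw [shinge, smax_pair, zero_div, Real.exp_zero]
  rw [smoothed, softl1, ssvm, SoftplusSum.val, Fintype.sum_sum_type]
  simp only [h1, h2, SoftplusSum.arg, svmSum, Sum.elim_inl, Sum.elim_inr, sum_inner,
    real_inner_smul_left, inner_single_one, dataMatrix_mulVec, inner_neg_left, add_zero,
    Finset.sum_add_distrib, ← Finset.mul_sum, Finset.sum_neg_distrib]
  simp only [sub_eq_neg_add]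
  ring

variable {lam a b μ}

/-- The largest eigenvalue of the Gram matrix bounds the quadratic form. -/
lemma sum_inner_sq_le (u : EuclideanSpace ℝ (Fin d)) :
    ∑ i, inner ℝ (b i • a i) u ^ 2 ≤ gramNorm (dataMatrix a b) * ‖u‖ ^ 2 := by
  set Q := dataMatrix a b with hQ
  have h1 : ∑ i, inner ℝ (b i • a i) u ^ 2
      = inner ℝ (Matrix.toEuclideanCLM (𝕜 := ℝ) (Qᵀ * Q) u) u := by
    have h2 : inner ℝ (Matrix.toEuclideanCLM (𝕜 := ℝ) (Qᵀ * Q) u) u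
        = ((Qᵀ * Q) *ᵥ fun j => u j) ⬝ᵥ fun j => u j := by
      simp only [PiLp.inner_apply, dotProduct, RCLike.inner_apply, conj_trivial]
      refine Finset.sum_congr rfl fun j _ => ?_
      rw [mul_comm]
      rfl
    rw [h2, ← Matrix.mulVec_mulVec, Matrix.mulVec_transpose, ← Matrix.dotProduct_mulVec]
    simp only [dotProduct, hQ, dataMatrix_mulVec, real_inner_smul_left]
    exact Finset.sum_congr rfl fun i _ => by ring
  rw [h1, gramNorm]
  refine (real_inner_le_norm _ _).trans ?_
  rw [sq, ← mul_assoc]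
  gcongr
  exact ContinuousLinearMap.le_opNorm _ _

lemma gramNorm_nonneg (Q : Matrix (Fin m) (Fin d) ℝ) : 0 ≤ gramNorm Q := norm_nonneg _

lemma norm_sq_data_le (i : Fin m) : ‖b i • a i‖ ^ 2 ≤ gramNorm (dataMatrix a b) := by
  set q := b i • a i with hq
  have h1 : inner ℝ q q ^ 2 ≤ gramNorm (dataMatrix a b) * ‖q‖ ^ 2 :=
    (Finset.single_le_sum (f := fun i => inner ℝ (b i • a i) q ^ 2) (fun i _ => sq_nonneg _)
      (Finset.mem_univ i)).trans (sum_inner_sq_le q)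
  rw [real_inner_self_eq_norm_sq] at h1
  rcases (sq_nonneg ‖q‖).eq_or_lt with h | h
  · rw [← h]; exact gramNorm_nonneg _
  · refine le_of_mul_le_mul_right ?_ h
    linarith

lemma one_div_natCast_le_one (hm : 0 < m) : 1 / (m : ℝ) ≤ 1 := by
  rw [div_le_one (by exact_mod_cast hm)]
  exact_mod_cast hm

lemma svmSum_bounded (hm : 0 < m) (hlam : 0 < lam) (hμ : 0 < μ) :
    (svmSum lam a b μ).Bounded (4 * lam + gramNorm (dataMatrix a b))
      (16 * lam + gramNorm (dataMatrix a b) ^ 2)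
      (3 * lam * d + gramNorm (dataMatrix a b) + 1) where
  μ_pos := hμ
  w_nonneg k := by
    rcases k with j | i
    · exact hlam.le
    · exact one_div_nonneg.2 (Nat.cast_nonneg m)
  L₂_nonneg := by
    have := gramNorm_nonneg (dataMatrix a b)
    positivity
  L₄_nonneg := by positivity
  quad u := by
    have h1 := sum_inner_sq_le (a := a) (b := b) u
    have h0 : 0 ≤ ∑ i, inner ℝ (b i • a i) u ^ 2 := Finset.sum_nonneg fun i _ => sq_nonneg _
    have hm1 := one_div_natCast_le_one hm
    have h2 : ∑ j, u j ^ 2 = ‖u‖ ^ 2 := (EuclideanSpace.real_norm_sq_eq u).symm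
    rw [Fintype.sum_sum_type]
    simp only [svmSum, Sum.elim_inl, Sum.elim_inr, inner_neg_left, neg_sq, ← Finset.mul_sum,
      real_inner_smul_left (EuclideanSpace.single _ _), inner_single_one, mul_pow, h2]
    nlinarith [mul_le_mul_of_nonneg_right hm1 h0]
  quart u z := by
    have hu := sum_inner_sq_le (a := a) (b := b) u
    have hz := sum_inner_sq_le (a := a) (b := b) z
    have hσ := gramNorm_nonneg (dataMatrix a b)
    have hm1 := one_div_natCast_le_one hm
    have h2 : ∀ u : EuclideanSpace ℝ (Fin d), ∑ j, u j ^ 2 = ‖u‖ ^ 2 := fun u =>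
      (EuclideanSpace.real_norm_sq_eq u).symm
    -- a sum of products is at most the product of the sums
    have h3 : ∀ {n : ℕ} (f g : Fin n → ℝ), (∀ i, 0 ≤ f i) → (∀ i, 0 ≤ g i) →
        ∑ i, f i * g i ≤ (∑ i, f i) * ∑ i, g i := by
      intro n f g hf hg
      rw [Finset.sum_mul]
      exact Finset.sum_le_sum fun i _ => mul_le_mul_of_nonneg_left
        (Finset.single_le_sum (fun i _ => hg i) (Finset.mem_univ i)) (hf i)
    have h4 := h3 (fun j => u j ^ 2) (fun j => z j ^ 2) (fun _ => sq_nonneg _) fun _ => sq_nonneg _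
    rw [h2, h2] at h4
    have h5 := h3 (fun i => inner ℝ (b i • a i) u ^ 2) (fun i => inner ℝ (b i • a i) z ^ 2)
      (fun _ => sq_nonneg _) fun _ => sq_nonneg _
    have h6 := h5.trans (mul_le_mul hu hz (Finset.sum_nonneg fun i _ => sq_nonneg _)
      (by positivity))
    have h7 : 0 ≤ ∑ i, inner ℝ (b i • a i) u ^ 2 * inner ℝ (b i • a i) z ^ 2 :=
      Finset.sum_nonneg fun i _ => by positivity
    rw [Fintype.sum_sum_type]
    simp only [svmSum, Sum.elim_inl, Sum.elim_inr, inner_neg_left, neg_sq, ← Finset.mul_sum,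
      real_inner_smul_left (EuclideanSpace.single _ _), inner_single_one, mul_pow]
    have h8 : ∑ j, 2 ^ 2 * u j ^ 2 * (2 ^ 2 * z j ^ 2) = 16 * ∑ j, u j ^ 2 * z j ^ 2 := by
      rw [Finset.mul_sum]
      exact Finset.sum_congr rfl fun j _ => by ring
    rw [h8]
    have h9 := mul_le_mul_of_nonneg_left h4 hlam.le
    have h10 := mul_le_mul_of_nonneg_right hm1 h7
    linarith
  grad_le x := by
    have hσ := gramNorm_nonneg (dataMatrix a b)
    have hm0 : (0 : ℝ) < m := by exact_mod_cast hm
    have h1 : ‖(svmSum lam a b μ).lin‖ ≤ lam * d := by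
      change ‖∑ j, (-lam) • EuclideanSpace.single j (1 : ℝ)‖ ≤ lam * d
      refine (norm_sum_le _ _).trans (le_of_eq ?_)
      simp [norm_smul, abs_of_pos hlam, mul_comm]
    have h2 : ∀ k, ‖((svmSum lam a b μ).w k * Real.sigmoid ((svmSum lam a b μ).arg x k))
        • (svmSum lam a b μ).v k‖ ≤ (svmSum lam a b μ).w k * ‖(svmSum lam a b μ).v k‖ := by
      intro k
      have hw : 0 ≤ (svmSum lam a b μ).w k := by
        rcases k with j | i
        · exact hlam.le
        · exact one_div_nonneg.2 (Nat.cast_nonneg m)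
      have hs := Real.sigmoid_nonneg ((svmSum lam a b μ).arg x k)
      rw [norm_smul, Real.norm_of_nonneg (mul_nonneg hw hs)]
      gcongr
      exact mul_le_of_le_one_right hw (Real.sigmoid_le_one _)
    have h3 : ∀ i, ‖b i • a i‖ ≤ gramNorm (dataMatrix a b) + 1 := by
      intro i
      have := norm_sq_data_le (a := a) (b := b) i
      nlinarith [sq_nonneg (‖b i • a i‖ - 1)]
    refine (norm_add_le _ _).trans ((add_le_add h1 ((norm_sum_le _ _).trans
      (Finset.sum_le_sum fun k _ => h2 k))).trans ?_)
    rw [Fintype.sum_sum_type]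
    simp only [svmSum, Sum.elim_inl, Sum.elim_inr, norm_neg, ← Finset.mul_sum]
    have h4 : ∑ j : Fin d, ‖(2 : ℝ) • EuclideanSpace.single j (1 : ℝ)‖ = 2 * d := by
      simp [norm_smul, mul_comm]
    have h5 : ∑ i, ‖b i • a i‖ ≤ m * (gramNorm (dataMatrix a b) + 1) := by
      refine (Finset.sum_le_sum fun i _ => h3 i).trans (le_of_eq ?_)
      simp [mul_add]
    rw [h4]
    have h6 := mul_le_mul_of_nonneg_left h5 (show 0 ≤ 1 / (m : ℝ) by positivity)
    rw [← mul_assoc, one_div_mul_cancel hm0.ne', one_mul] at h6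
    linarith

lemma isOracleFor_answer (hm : 0 < m) (hlam : 0 < lam) (hμ : 0 < μ) :
    IsOracleFor (answer (smoothed lam a b μ)) (svmSum lam a b μ) := by
  have hP := svmSum_bounded (a := a) (b := b) hm hlam hμ
  have hg : gradient (smoothed lam a b μ) = (svmSum lam a b μ).grad := by
    rw [smoothed_eq_val _ _ _ _ hμ]
    exact gradient_eq fun x => (svmSum lam a b μ).hasGradientAt_val hμ x
  refine ⟨fun x => by rw [answer, hg], fun x τ z => ?_⟩
  rw [answer, hg, ((svmSum lam a b μ).hasFDerivAt_grad x).fderiv]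
  refine (isInvertible_of_coercive τ.2 fun u => ?_).self_apply_inverse z
  rw [SoftplusSum.hess, SoftplusSum.inner_form_add_smul]
  have := (svmSum lam a b μ).inner_form_self_nonneg hP.w_nonneg
    (hP.sigCurv_div_nonneg ((svmSum lam a b μ).arg x)) u
  linarith

lemma objective_le_smoothed (hlam : 0 < lam) (hμ : 0 < μ) (x : EuclideanSpace ℝ (Fin d)) :
    objective lam a b x ≤ smoothed lam a b μ x := by
  unfold objective smoothed softl1 ssvm
  refine add_le_add (mul_le_mul_of_nonneg_left (Finset.sum_le_sum fun j _ => ?_) hlam.le)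
    (mul_le_mul_of_nonneg_left (Finset.sum_le_sum fun i _ => ?_) (by positivity))
  · exact max_le_smax hμ _ _
  · rw [dataMatrix_mulVec]
    exact max_le_smax hμ _ _

lemma smoothed_le_objective_add (hm : 0 < m) (hlam : 0 < lam) (hμ : 0 < μ)
    (x : EuclideanSpace ℝ (Fin d)) :
    smoothed lam a b μ x ≤ objective lam a b x + (lam * d + 1) * (μ * Real.log 2) := by
  have hm0 : (0 : ℝ) < m := by exact_mod_cast hm
  unfold objective smoothed softl1 ssvm
  have h1 : ∑ j, sabs μ (x j) ≤ ∑ j, |x j| + d * (μ * Real.log 2) := by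
    refine (Finset.sum_le_sum fun j _ => smax_le_max_add hμ (x j) (-(x j))).trans (le_of_eq ?_)
    rw [Finset.sum_add_distrib]
    simp [abs]
  have h2 : ∑ i, shinge μ (1 - (dataMatrix a b *ᵥ fun j => x j) i)
      ≤ ∑ i, max 0 (1 - b i * inner ℝ (a i) x) + m * (μ * Real.log 2) := by
    refine (Finset.sum_le_sum fun i _ => smax_le_max_add hμ 0 _).trans (le_of_eq ?_)
    rw [Finset.sum_add_distrib]
    simp [dataMatrix_mulVec]
  have h3 := mul_le_mul_of_nonneg_left h1 hlam.le
  have h4 := mul_le_mul_of_nonneg_left h2 (show 0 ≤ 1 / (m : ℝ) by positivity)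
  rw [mul_add (1 / (m : ℝ)), ← mul_assoc (1 / (m : ℝ)) (m : ℝ), one_div_mul_cancel hm0.ne',
    one_mul] at h4
  linarith

/-- The Lipschitz bound for the objective, which takes care of the case without any iteration. -/
lemma objective_sub_le (hm : 0 < m) (hlam : 0 < lam) (x y : EuclideanSpace ℝ (Fin d)) :
    objective lam a b x - objective lam a b y
      ≤ (lam * d + √(gramNorm (dataMatrix a b))) * ‖x - y‖ := by
  have hm0 : (0 : ℝ) < m := by exact_mod_cast hm
  have h1 : ∑ j, |x j| ≤ ∑ j, |y j| + d * ‖x - y‖ := by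
    have : ∀ j ∈ Finset.univ, |x j| ≤ |y j| + ‖x - y‖ := by
      intro j _
      have h2 : |x j - y j| ≤ ‖x - y‖ := by
        have := PiLp.norm_apply_le (x - y) j
        simpa [Real.norm_eq_abs] using this
      have h3 := abs_sub_abs_le_abs_sub (x j) (y j)
      linarith
    refine (Finset.sum_le_sum this).trans (le_of_eq ?_)
    rw [Finset.sum_add_distrib]
    simp
  have h2 : ∑ i, max 0 (1 - b i * inner ℝ (a i) x)
      ≤ ∑ i, max 0 (1 - b i * inner ℝ (a i) y)
        + m * (√(gramNorm (dataMatrix a b)) * ‖x - y‖) := by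
    have : ∀ i ∈ Finset.univ, max 0 (1 - b i * inner ℝ (a i) x)
        ≤ max 0 (1 - b i * inner ℝ (a i) y) + √(gramNorm (dataMatrix a b)) * ‖x - y‖ := by
      intro i _
      have h3 : ‖b i • a i‖ ≤ √(gramNorm (dataMatrix a b)) :=
        Real.le_sqrt_of_sq_le (norm_sq_data_le i)
      have h4 : inner ℝ (b i • a i) (y - x) ≤ √(gramNorm (dataMatrix a b)) * ‖x - y‖ := by
        refine (real_inner_le_norm _ _).trans ?_
        rw [norm_sub_rev]
        gcongr
      rw [real_inner_smul_left, inner_sub_right, mul_sub] at h4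
      refine max_le ?_ ?_
      · have : 0 ≤ √(gramNorm (dataMatrix a b)) * ‖x - y‖ := by positivity
        linarith [le_max_left 0 (1 - b i * inner ℝ (a i) y)]
      · linarith [le_max_right 0 (1 - b i * inner ℝ (a i) y)]
    refine (Finset.sum_le_sum this).trans (le_of_eq ?_)
    rw [Finset.sum_add_distrib]
    simp
  have h3 := mul_le_mul_of_nonneg_left h1 hlam.le
  have h4 := mul_le_mul_of_nonneg_left h2 (show 0 ≤ 1 / (m : ℝ) by positivity)
  rw [mul_add (1 / (m : ℝ)), ← mul_assoc (1 / (m : ℝ)) (m : ℝ), one_div_mul_cancel hm0.ne',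
    one_mul] at h4
  unfold objective
  linarith

end Objective

/-! ### The constants of the method -/

section Constants

/-- The fifth power of the iteration bound is `complexity * R ^ 4`. -/
def complexity (d : ℕ) (lam σ ε : ℝ) : ℝ := max 1 (lam * d) ^ 3 * (lam * d + σ ^ 2) / ε ^ 4

lemma iterBound_pow {d : ℕ} {lam σ R ε : ℝ} (hlam : 0 < lam) (hR : 0 ≤ R) (hε : 0 < ε) :
    iterBound d lam σ R ε ^ 5 = complexity d lam σ ε * R ^ 4 := by
  have hK : (0 : ℝ) ≤ max 1 (lam * d) := zero_le_one.trans (le_max_left _ _)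
  have hD : 0 ≤ lam * d + σ ^ 2 := by positivity
  have key : ∀ (t q : ℝ) (n : ℕ), 0 ≤ t → q * 5 = n → (t ^ q) ^ 5 = t ^ n := by
    intro t q n ht hq
    rw [← Real.rpow_natCast, ← Real.rpow_mul ht, ← Real.rpow_natCast t n, ← hq]
    norm_num
  rw [iterBound, div_pow, mul_pow, mul_pow, key _ _ 3 hK (by norm_num), key _ _ 1 hD (by norm_num),
    key _ _ 4 hR (by norm_num), key _ _ 4 hε.le (by norm_num), complexity]
  ring

lemma iterBound_nonneg {d : ℕ} {lam σ R ε : ℝ} (hlam : 0 < lam) (hR : 0 ≤ R) (hε : 0 < ε) :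
    0 ≤ iterBound d lam σ R ε := by
  have hK : (0 : ℝ) ≤ max 1 (lam * d) := zero_le_one.trans (le_max_left _ _)
  have hD : 0 ≤ lam * d + σ ^ 2 := by positivity
  unfold iterBound
  positivity

/-- The distance for which the iteration bound, with the constant `100`, equals `N + 1`. The method
does not know `‖x₀ - x*‖`, but as it knows `N`, this is an upper bound that is tight up to a constant
factor. -/
def radius (d : ℕ) (lam σ ε : ℝ) (N : ℕ) : ℝ :=
  (((N : ℝ) + 1) ^ 5 / (100 ^ 5 * complexity d lam σ ε)) ^ (1 / 4 : ℝ)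

/-- The bound for the Hessians of the smoothed objective. -/
def hessBound (d : ℕ) (lam σ ε : ℝ) : ℝ := (4 * lam + σ) / (4 * smoothingParam d lam ε)

/-- The modulus of the quadratic growth of the Hessians of the smoothed objective. -/
def stabBound (d : ℕ) (lam σ ε : ℝ) : ℝ :=
  (16 * lam + σ ^ 2) / (4 * smoothingParam d lam ε ^ 3)

/-- A lower bound for the parameters of the proximal subproblems. -/
def minProx (r ε : ℝ) : ℝ := ε / (243 * r ^ 2)

/-- The constants for the `l1`-SVM, where `r` is a bound for the distance to the solution. -/
def svmParams (d : ℕ) (lam σ ε r : ℝ) (N : ℕ) : AccelParams where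
  Λ := stabBound d lam σ ε
  n := ⌈Real.log (1024 * ((hessBound d lam σ ε + minProx r ε) / minProx r ε) ^ 3)
    / Real.log (4 / 3)⌉₊
  J := ⌈Real.log (1 + 16 * stabBound d lam σ ε * (3 * lam * d + σ + 1) ^ 2 / minProx r ε ^ 3)
    / Real.log (16 / 15)⌉₊
  scale := 32 * r ^ 2 / (ε * N ^ 5)
  target := r ^ 2 / ε

lemma le_pow_ceil_log_div {X b : ℝ} (hb : 1 < b) (hX : 0 < X) :
    X ≤ b ^ ⌈Real.log X / Real.log b⌉₊ := by
  have h1 := Nat.le_ceil (Real.log X / Real.log b)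
  rw [div_le_iff₀ (Real.log_pos hb)] at h1
  rw [← Real.log_le_log_iff hX (by positivity), Real.log_pow]
  exact h1

/-- A bound on the number of steps in terms of a bound `M` for the logarithm. -/
lemma ceil_log_div_le {X b M s : ℝ} (hs : 0 < s) (hb : s ≤ Real.log b) (hM : 0 ≤ M)
    (hX : Real.log X ≤ M) : (⌈Real.log X / Real.log b⌉₊ : ℝ) ≤ M / s + 1 := by
  have h0 : 0 ≤ M / s := by positivity
  have h1 : Real.log X / Real.log b ≤ M / s :=
    (div_le_div_of_nonneg_right hX (hs.le.trans hb)).trans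
      (div_le_div_of_nonneg_left hM hs hb)
  exact (Nat.cast_le.2 (Nat.ceil_mono h1)).trans (Nat.ceil_lt_add_one h0).le

variable {d m N : ℕ} {lam σ ε R : ℝ}

lemma complexity_pos (hlam : 0 < lam) (hε : 0 < ε) (hd : 0 < d) : 0 < complexity d lam σ ε := by
  have hK : (0 : ℝ) < max 1 (lam * d) := lt_max_of_lt_left one_pos
  have hd' : (0 : ℝ) < d := by exact_mod_cast hd
  unfold complexity
  positivity

lemma radius_pow (hlam : 0 < lam) (hε : 0 < ε) (hd : 0 < d) :
    complexity d lam σ ε * radius d lam σ ε N ^ 4 = ((N : ℝ) + 1) ^ 5 / 100 ^ 5 := by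
  have hM := complexity_pos (σ := σ) hlam hε hd
  rw [radius, ← Real.rpow_natCast _ 4, ← Real.rpow_mul (by positivity)]
  norm_num
  field_simp

lemma radius_pos (hlam : 0 < lam) (hε : 0 < ε) (hd : 0 < d) : 0 < radius d lam σ ε N := by
  have hM := complexity_pos (σ := σ) hlam hε hd
  unfold radius
  positivity

lemma floor_bounds (hlam : 0 < lam) (hε : 0 < ε) (hR : 0 ≤ R)
    (hN : N = ⌊100 * iterBound d lam σ R ε⌋₊) :
    (N : ℝ) ^ 5 ≤ 100 ^ 5 * (complexity d lam σ ε * R ^ 4) ∧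
      100 ^ 5 * (complexity d lam σ ε * R ^ 4) < ((N : ℝ) + 1) ^ 5 := by
  have h0 := iterBound_nonneg (d := d) (σ := σ) hlam hR hε
  have h1 : (N : ℝ) ≤ 100 * iterBound d lam σ R ε := by
    rw [hN]; exact Nat.floor_le (by positivity)
  have h2 : 100 * iterBound d lam σ R ε < (N : ℝ) + 1 := by
    rw [hN]; exact Nat.lt_floor_add_one _
  rw [← iterBound_pow hlam hR hε, ← mul_pow]
  constructor
  · gcongr
  · gcongr

lemma le_radius (hlam : 0 < lam) (hε : 0 < ε) (hd : 0 < d) (hR : 0 ≤ R)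
    (hN : N = ⌊100 * iterBound d lam σ R ε⌋₊) : R ≤ radius d lam σ ε N := by
  have hM := complexity_pos (σ := σ) hlam hε hd
  have h1 := (floor_bounds hlam hε hR hN).2
  have h2 := radius_pow (σ := σ) (N := N) hlam hε hd
  refine le_of_pow_le_pow_left₀ (n := 4) (by norm_num) (radius_pos hlam hε hd).le ?_
  refine le_of_mul_le_mul_left ?_ hM
  rw [h2, le_div_iff₀ (by positivity)]
  linarith

lemma radius_le (hlam : 0 < lam) (hε : 0 < ε) (hd : 0 < d) (hR : 0 ≤ R)
    (hN : N = ⌊100 * iterBound d lam σ R ε⌋₊) (hN1 : 1 ≤ N) : radius d lam σ ε N ≤ 3 * R := by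
  have hM := complexity_pos (σ := σ) hlam hε hd
  have h1 := (floor_bounds hlam hε hR hN).1
  have h2 := radius_pow (σ := σ) (N := N) hlam hε hd
  have hN1' : (1 : ℝ) ≤ N := by exact_mod_cast hN1
  have h3 : ((N : ℝ) + 1) ^ 5 ≤ (2 * N) ^ 5 := by
    gcongr
    linarith
  refine le_of_pow_le_pow_left₀ (n := 4) (by norm_num) (by positivity) ?_
  refine le_of_mul_le_mul_left ?_ hM
  rw [h2, div_le_iff₀ (by positivity)]
  have h4 : 0 ≤ complexity d lam σ ε * R ^ 4 := by positivity
  linarith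

lemma smoothingParam_pos (hε : 0 < ε) : 0 < smoothingParam d lam ε := by
  have : (0 : ℝ) < max 1 (lam * d) := lt_max_of_lt_left one_pos
  unfold smoothingParam
  positivity

/-- The modulus `Λ` is at most `256 ε` times the complexity; this is where `λ ≤ λ d` enters. -/
lemma stabBound_le (hlam : 0 < lam) (hε : 0 < ε) (hd : 0 < d) :
    stabBound d lam σ ε ≤ 256 * (ε * complexity d lam σ ε) := by
  have hK : (0 : ℝ) < max 1 (lam * d) := lt_max_of_lt_left one_pos
  have hd' : (1 : ℝ) ≤ d := by exact_mod_cast hd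
  have h1 : 16 * lam + σ ^ 2 ≤ 16 * (lam * d + σ ^ 2) := by nlinarith [sq_nonneg σ]
  calc stabBound d lam σ ε
      = 16 * (16 * lam + σ ^ 2) * max 1 (lam * d) ^ 3 / ε ^ 3 := by
        unfold stabBound smoothingParam
        field_simp
        norm_num
    _ ≤ 16 * (16 * (lam * d + σ ^ 2)) * max 1 (lam * d) ^ 3 / ε ^ 3 := by gcongr
    _ = _ := by
        unfold complexity
        field_simp
        ring

lemma svmParams_good (hlam : 0 < lam) (hε : 0 < ε) (hσ : 0 ≤ σ) {r : ℝ} (hr : 0 < r)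
    (hN1 : 1 ≤ N) :
    (svmParams d lam σ ε r N).Good (hessBound d lam σ ε) (3 * lam * d + σ + 1) (N / 2)
      (minProx r ε) (1 / (3750 * (stabBound d lam σ ε * (32 * r ^ 2 / (ε * N ^ 5)) * N))) := by
  have hμ := smoothingParam_pos (d := d) (lam := lam) hε
  have hN1' : (1 : ℝ) ≤ N := by exact_mod_cast hN1
  have hN0 : (0 : ℝ) < N := by linarith
  have hΛ : 0 < stabBound d lam σ ε := by unfold stabBound; positivity
  have hβ : 0 < hessBound d lam σ ε := by unfold hessBound; positivity
  have hℓ : 0 < minProx r ε := by unfold minProx; positivity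
  refine ⟨?_, by positivity, ?_, hℓ, ?_, ?_, ?_, by positivity, ?_⟩
  · simp only [svmParams]
    positivity
  · simp only [svmParams]
    field_simp
    norm_num
  · simp only [svmParams, minProx]
    have h1 : ((N : ℝ) / 2 + 1) ^ 5 ≤ (3 / 2 * N) ^ 5 := by
      gcongr
      linarith
    calc ε / (243 * r ^ 2) * (32 * r ^ 2 / (ε * N ^ 5) * ((N : ℝ) / 2 + 1) ^ 5)
        ≤ ε / (243 * r ^ 2) * (32 * r ^ 2 / (ε * N ^ 5) * (3 / 2 * N) ^ 5) := by gcongr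
      _ = 1 := by field_simp; norm_num
  · exact le_pow_ceil_log_div (by norm_num) (by positivity)
  · set X := 1 + 16 * stabBound d lam σ ε * (3 * lam * d + σ + 1) ^ 2 / minProx r ε ^ 3 with hX
    have h1 : X ≤ (16 / 15) ^ (svmParams d lam σ ε r N).J :=
      le_pow_ceil_log_div (by norm_num) (by positivity)
    have h2 : (1 : ℝ) ≤ (16 / 15) ^ (svmParams d lam σ ε r N).J := one_le_pow₀ (by norm_num)
    set Y := (16 / 15 : ℝ) ^ (svmParams d lam σ ε r N).J
    have h3 : Y ≤ Y ^ 3 := by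
      calc Y = Y ^ 1 := (pow_one Y).symm
        _ ≤ Y ^ 3 := pow_le_pow_right₀ h2 (by norm_num)
    have h4 : 16 * stabBound d lam σ ε * (3 * lam * d + σ + 1) ^ 2 / minProx r ε ^ 3 ≤ Y ^ 3 := by
      linarith
    rw [div_le_iff₀ (by positivity)] at h4
    rw [mul_pow, mul_comm (minProx r ε ^ 3)]
    exact h4
  · simp only [svmParams]
    set S := 32 * r ^ 2 / (ε * N ^ 5) with hS
    have hS0 : 0 < S := by positivity
    rw [one_div_mul_eq_div, div_le_iff₀ (by positivity)]
    have h1 : (N : ℝ) / 2 + 1 ≤ 3 / 2 * N := by linarith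
    have h2 := mul_le_mul_of_nonneg_left h1 (show 0 ≤ stabBound d lam σ ε * S by positivity)
    have h3 : 0 ≤ stabBound d lam σ ε * S * N := by positivity
    nlinarith

/-! ### Accuracy and number of oracle calls -/

lemma log_two_le_one : Real.log 2 ≤ 1 := by
  have := Real.log_le_sub_one_of_pos (show (0 : ℝ) < 2 by norm_num)
  linarith

/-- The final accuracy: half of it is the optimization error, and half the smoothing error. -/
theorem objective_iterate_sub_le (hm : 0 < m) (hd : 0 < d) (hlam : 0 < lam) (hε : 0 < ε)
    {a : Fin m → EuclideanSpace ℝ (Fin d)} {b : Fin m → ℝ} {x₀ u : EuclideanSpace ℝ (Fin d)}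
    (hu : ∀ x, objective lam a b u ≤ objective lam a b x)
    (hσ : σ = gramNorm (dataMatrix a b)) (hR : ‖x₀ - u‖ ≤ radius d lam σ ε N) (hN1 : 1 ≤ N) :
    objective lam a b (((svmParams d lam σ ε (radius d lam σ ε N) N).method d).iterate
        (answer (smoothed lam a b (smoothingParam d lam ε))) x₀ N) - objective lam a b u ≤ ε := by
  have hσ0 : 0 ≤ σ := hσ ▸ gramNorm_nonneg _
  have hμ := smoothingParam_pos (d := d) (lam := lam) hε
  have hr := radius_pos (σ := σ) (N := N) hlam hε hd
  have hrpow := radius_pow (σ := σ) (N := N) hlam hε hd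
  have hgood := svmParams_good (d := d) hlam hε hσ0 hr hN1
  have hP := svmSum_bounded (a := a) (b := b) hm hlam hμ
  rw [← hσ] at hP
  have hO := isOracleFor_answer (a := a) (b := b) hm hlam hμ
  have hval := smoothed_eq_val lam a b _ hμ
  have hN1' : (1 : ℝ) ≤ N := by exact_mod_cast hN1
  have hN0 : (0 : ℝ) < N := by linarith
  -- the smoothing error
  have hsm : (lam * d + 1) * (smoothingParam d lam ε * Real.log 2) ≤ ε / 2 := by
    have hK1 : (1 : ℝ) ≤ max 1 (lam * d) := le_max_left _ _
    have hK2 : lam * d ≤ max 1 (lam * d) := le_max_right _ _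
    calc (lam * d + 1) * (smoothingParam d lam ε * Real.log 2)
        ≤ (2 * max 1 (lam * d)) * (smoothingParam d lam ε * 1) := by
          have := log_two_le_one
          gcongr
          linarith
      _ = ε / 2 := by
          unfold smoothingParam
          field_simp
          norm_num
  have hup : ∀ x, objective lam a b x ≤ (svmSum lam a b (smoothingParam d lam ε)).val x := by
    intro x
    rw [← hval]
    exact objective_le_smoothed hlam hμ x
  have hlow : (svmSum lam a b (smoothingParam d lam ε)).val u ≤ objective lam a b u + ε / 2 := by
    rw [← hval]
    linarith [smoothed_le_objective_add (a := a) (b := b) hm hlam hμ u]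
  set r := radius d lam σ ε N with hrdef
  have hmain := hgood.val_iterate_sub_le hP hO rfl (u := u) (x₀ := x₀) (δ := ε / 2) (R := r)
    (N := N) (fun x => by linarith [hup x, hu x]) (by positivity) hR (by
      have h1 : r ^ 2 / 2 + (svmParams d lam σ ε r N).target * (ε / 2) = r ^ 2 := by
        simp only [svmParams]
        field_simp
        norm_num
      have hΛ : 0 < stabBound d lam σ ε := by unfold stabBound; positivity
      have h2 : 1 / (3750 * (stabBound d lam σ ε * (32 * r ^ 2 / (ε * N ^ 5)) * N)) * (N - N / 2)
          = ε * N ^ 5 / (240000 * stabBound d lam σ ε * r ^ 2) := by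
        field_simp
        norm_num
      rw [h1, h2, lt_div_iff₀ (by positivity)]
      have h3 : stabBound d lam σ ε * r ^ 4 ≤ 256 * ε * (((N : ℝ) + 1) ^ 5 / 100 ^ 5) := by
        rw [← hrpow]
        have := mul_le_mul_of_nonneg_right (stabBound_le (σ := σ) hlam hε hd)
          (show 0 ≤ r ^ 4 by positivity)
        linarith
      have h4 : ((N : ℝ) + 1) ^ 5 ≤ (2 * N) ^ 5 := by
        gcongr
        linarith
      have h5 := mul_le_mul_of_nonneg_left h4 hε.le
      have h6 : 0 < ε * (N : ℝ) ^ 5 := by positivity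
      nlinarith)
  have htarget : r ^ 2 / (2 * (svmParams d lam σ ε r N).target) = ε / 2 := by
    simp only [svmParams]
    field_simp
  rw [htarget] at hmain
  linarith [hup (((svmParams d lam σ ε r N).method d).iterate
    (answer (smoothed lam a b (smoothingParam d lam ε))) x₀ N)]

/-- If the iteration bound is small, then the starting point is accurate enough. -/
lemma objective_start_sub_le (hm : 0 < m) (hlam : 0 < lam) (hε : 0 < ε)
    {a : Fin m → EuclideanSpace ℝ (Fin d)} {b : Fin m → ℝ} {x₀ u : EuclideanSpace ℝ (Fin d)}
    (hσ : σ = gramNorm (dataMatrix a b)) (hR : R = ‖x₀ - u‖)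
    (h : 100 ^ 5 * (complexity d lam σ ε * R ^ 4) < 1) :
    objective lam a b x₀ - objective lam a b u ≤ ε := by
  have hσ0 : 0 ≤ σ := hσ ▸ gramNorm_nonneg _
  have hR0 : 0 ≤ R := hR ▸ norm_nonneg _
  have hK1 : (1 : ℝ) ≤ max 1 (lam * d) := le_max_left _ _
  have hK2 : lam * d ≤ max 1 (lam * d) := le_max_right _ _
  have hc : complexity d lam σ ε * R ^ 4
      = max 1 (lam * d) ^ 3 * (lam * d + σ ^ 2) * R ^ 4 / ε ^ 4 := by
    unfold complexity; ring
  rw [hc, mul_div_assoc', div_lt_one (by positivity)] at h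
  have hld : 0 ≤ lam * d := by positivity
  set K := max 1 (lam * d)
  have h1 : lam * d * R ≤ ε / 2 := by
    refine le_of_pow_le_pow_left₀ (n := 4) (by norm_num) (by positivity) ?_
    have e1 : (lam * d) ^ 3 * (lam * d) ≤ K ^ 3 * (lam * d + σ ^ 2) := by
      gcongr
      linarith [sq_nonneg σ]
    have e2 := mul_le_mul_of_nonneg_right e1 (show 0 ≤ R ^ 4 by positivity)
    have e3 : 0 ≤ (lam * d) ^ 3 * (lam * d) * R ^ 4 := by positivity
    have e4 : (lam * d * R) ^ 4 = (lam * d) ^ 3 * (lam * d) * R ^ 4 := by ring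
    rw [e4, div_pow]
    linarith
  have h2 : √σ * R ≤ ε / 2 := by
    refine le_of_pow_le_pow_left₀ (n := 4) (by norm_num) (by positivity) ?_
    have e0 : √σ ^ 4 = σ ^ 2 := by
      rw [show √σ ^ 4 = (√σ ^ 2) ^ 2 by ring, Real.sq_sqrt hσ0]
    have e1 : 1 ^ 3 * σ ^ 2 ≤ K ^ 3 * (lam * d + σ ^ 2) := by
      gcongr
      linarith
    have e2 := mul_le_mul_of_nonneg_right e1 (show 0 ≤ R ^ 4 by positivity)
    have e3 : 0 ≤ σ ^ 2 * R ^ 4 := by positivity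
    rw [mul_pow, e0, div_pow]
    linarith
  have h3 := objective_sub_le (a := a) (b := b) hm hlam x₀ u
  rw [← hσ, ← hR, add_mul] at h3
  linarith

/-- If the method makes an iteration, then `ε` is polynomially bounded. -/
lemma le_pow_of_floor_pos {W : ℝ} (hW : 4 ≤ W) (hld : lam * d ≤ W ^ 2) (hlam : 0 < lam) (hε : 0 < ε)
    (hσ : 0 ≤ σ) (hσW : σ ≤ W) (hR : 0 ≤ R) (hRW : R ≤ W)
    (h : 1 ≤ 100 ^ 5 * (complexity d lam σ ε * R ^ 4)) : ε ≤ W ^ 8 := by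
  have hW0 : 0 < W := by linarith
  have hKW : max 1 (lam * d) ≤ W ^ 2 := max_le (by nlinarith) hld
  have hK0 : 0 ≤ max 1 (lam * d) := zero_le_one.trans (le_max_left _ _)
  refine le_of_pow_le_pow_left₀ (n := 4) (by norm_num) (by positivity) ?_
  have e2 : complexity d lam σ ε * R ^ 4
      = max 1 (lam * d) ^ 3 * (lam * d + σ ^ 2) * R ^ 4 / ε ^ 4 := by
    unfold complexity; ring
  rw [e2, mul_div_assoc', le_div_iff₀ (by positivity), one_mul] at h
  generalize max 1 (lam * d) = K at *
  have hld0 : 0 ≤ lam * d := by positivity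
  generalize lam * d = t at *
  calc ε ^ 4 ≤ 100 ^ 5 * (K ^ 3 * (t + σ ^ 2) * R ^ 4) := h
    _ ≤ 100 ^ 5 * ((W ^ 2) ^ 3 * (W ^ 2 + W ^ 2) * W ^ 4) := by gcongr
    _ = 20000000000 * W ^ 12 := by ring
    _ ≤ 4 ^ 20 * W ^ 12 := by gcongr; norm_num
    _ ≤ W ^ 20 * W ^ 12 := by gcongr
    _ = (W ^ 8) ^ 4 := by ring

/-- The condition number of the proximal subproblems is polynomially bounded. -/
lemma hessBound_div_minProx_le {W r : ℝ} (hW : 4 ≤ W) (hld : lam * d ≤ W ^ 2) (hlam : 0 < lam)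
    (hε : 0 < ε) (hlW : lam ≤ W) (hσ : 0 ≤ σ) (hσW : σ ≤ W) (hr : 0 < r) (hrW : r ≤ 3 * W) :
    hessBound d lam σ ε / minProx r ε ≤ (W ^ 20 / ε) ^ 2 := by
  have hW0 : 0 < W := by linarith
  have hKW : max 1 (lam * d) ≤ W ^ 2 := max_le (by nlinarith) hld
  have hK0 : 0 < max 1 (lam * d) := lt_max_of_lt_left one_pos
  have e1 : hessBound d lam σ ε / minProx r ε
      = (4 * lam + σ) * max 1 (lam * d) * (243 * r ^ 2) / ε ^ 2 := by
    unfold hessBound minProx smoothingParam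
    field_simp
  rw [e1, div_pow]
  generalize max 1 (lam * d) = K at *
  gcongr
  calc (4 * lam + σ) * K * (243 * r ^ 2) ≤ (4 * W + W) * W ^ 2 * (243 * (3 * W) ^ 2) := by gcongr
    _ = 10935 * W ^ 5 := by ring
    _ ≤ 4 ^ 35 * W ^ 5 := by gcongr; norm_num
    _ ≤ W ^ 35 * W ^ 5 := by gcongr
    _ = (W ^ 20) ^ 2 := by ring

/-- The range of the parameters of the proximal subproblems is polynomially bounded. -/
lemma stabBound_div_minProx_le {W r : ℝ} (hW : 4 ≤ W) (hld : lam * d ≤ W ^ 2) (hlam : 0 < lam)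
    (hε : 0 < ε) (hlW : lam ≤ W) (hσ : 0 ≤ σ) (hσW : σ ≤ W) (hr : 0 < r) (hrW : r ≤ 3 * W) :
    16 * stabBound d lam σ ε * (3 * lam * d + σ + 1) ^ 2 / minProx r ε ^ 3 ≤ (W ^ 20 / ε) ^ 6 := by
  have hW0 : 0 < W := by linarith
  have hKW : max 1 (lam * d) ≤ W ^ 2 := max_le (by nlinarith) hld
  have hK0 : 0 < max 1 (lam * d) := lt_max_of_lt_left one_pos
  have hld0 : 0 ≤ lam * d := by positivity
  have f1 : 16 * stabBound d lam σ ε * (3 * lam * d + σ + 1) ^ 2 / minProx r ε ^ 3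
      = 256 * (16 * lam + σ ^ 2) * max 1 (lam * d) ^ 3 * (3 * (lam * d) + σ + 1) ^ 2
        * (243 * r ^ 2) ^ 3 / ε ^ 6 := by
    unfold stabBound minProx smoothingParam
    field_simp
    norm_num
  have f2 : 16 * lam + σ ^ 2 ≤ 5 * W ^ 2 := by nlinarith
  have f3 : 3 * (lam * d) + σ + 1 ≤ 4 * W ^ 2 := by nlinarith
  rw [f1, div_pow]
  generalize max 1 (lam * d) = K at *
  generalize lam * d = t at *
  gcongr
  calc 256 * (16 * lam + σ ^ 2) * K ^ 3 * (3 * t + σ + 1) ^ 2 * (243 * r ^ 2) ^ 3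
      ≤ 256 * (5 * W ^ 2) * (W ^ 2) ^ 3 * (4 * W ^ 2) ^ 2 * (243 * (3 * W) ^ 2) ^ 3 := by gcongr
    _ = 214228033597440 * W ^ 18 := by ring
    _ ≤ 4 ^ 102 * W ^ 18 := by gcongr; norm_num
    _ ≤ W ^ 102 * W ^ 18 := by gcongr
    _ = (W ^ 20) ^ 6 := by ring

/-- The number of oracle calls in an iteration is polylogarithmic. All quantities are bounded by
powers of `W = 2 + d + m + lam + σ + R ≥ 4` and of `1 / ε`, and `ε ≤ W ^ 8`, because otherwise the
number of iterations would be zero. -/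
theorem calls_le (hm : 0 < m) (hd : 0 < d) (hlam : 0 < lam) (hε : 0 < ε) (hσ : 0 ≤ σ) (hR : 0 ≤ R)
    (hN : N = ⌊100 * iterBound d lam σ R ε⌋₊) (hN1 : 1 ≤ N) :
    (((svmParams d lam σ ε (radius d lam σ ε N) N).n * 2
      + (svmParams d lam σ ε (radius d lam σ ε N) N).J
        * ((svmParams d lam σ ε (radius d lam σ ε N) N).n * 2) + 1 : ℕ) : ℝ)
      ≤ 100 * Real.log (2 + paramZ 20 d m lam σ R / ε) ^ 20 := by
  have hr0 := radius_pos (σ := σ) (N := N) hlam hε hd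
  have hrR := radius_le (σ := σ) hlam hε hd hR hN hN1
  have hN5 := (floor_bounds (σ := σ) hlam hε hR hN).1
  generalize radius d lam σ ε N = r at *
  have hd' : (1 : ℝ) ≤ d := by exact_mod_cast hd
  have hm' : (1 : ℝ) ≤ m := by exact_mod_cast hm
  have hN1' : (1 : ℝ) ≤ N := by exact_mod_cast hN1
  rw [paramZ]
  obtain ⟨W, hW⟩ : ∃ W : ℝ, W = 2 + d + m + lam + σ + R := ⟨_, rfl⟩
  rw [← hW]
  have hW4 : 4 ≤ W := by linarith
  have hW0 : 0 < W := by linarith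
  have hlW : lam ≤ W := by linarith
  have hσW : σ ≤ W := by linarith
  have hRW : R ≤ W := by linarith
  have hrW : r ≤ 3 * W := by linarith
  have hld : lam * d ≤ W ^ 2 := by
    rw [sq]
    exact mul_le_mul hlW (by linarith) (by positivity) hW0.le
  have hεW := le_pow_of_floor_pos hW4 hld hlam hε hσ hσW hR hRW ((one_le_pow₀ hN1').trans hN5)
  have hcond := hessBound_div_minProx_le hW4 hld hlam hε hlW hσ hσW hr0 hrW
  have hrange := stabBound_div_minProx_le hW4 hld hlam hε hlW hσ hσW hr0 hrW
  have hzW : W ^ 12 ≤ W ^ 20 / ε := by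
    rw [le_div_iff₀ hε]
    calc W ^ 12 * ε ≤ W ^ 12 * W ^ 8 := by gcongr
      _ = W ^ 20 := by ring
  have hz12 : (4 : ℝ) ^ 12 ≤ W ^ 20 / ε := le_trans (by gcongr) hzW
  have hz0 : 0 < W ^ 20 / ε := by positivity
  generalize W ^ 20 / ε = z at *
  have hlog4 : 9 ≤ Real.log (2 + z) := by
    have e2 := Real.log_le_log (by norm_num) (hz12.trans (by linarith : z ≤ 2 + z))
    rw [Real.log_pow] at e2
    have e3 := Real.one_sub_inv_le_log_of_pos (show (0 : ℝ) < 4 by norm_num)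
    norm_num at e2 e3
    linarith
  have hy2 : 2 ≤ 2 + z := by linarith
  have hβ : 0 < hessBound d lam σ ε := by
    have hμ := smoothingParam_pos (d := d) (lam := lam) hε
    unfold hessBound; positivity
  have hΛ : 0 < stabBound d lam σ ε := by
    have hμ := smoothingParam_pos (d := d) (lam := lam) hε
    unfold stabBound; positivity
  have hℓ : 0 < minProx r ε := by unfold minProx; positivity
  have hn : ((svmParams d lam σ ε r N).n : ℝ) ≤ 16 * Real.log (2 + z) / (1 / 4) + 1 := by
    refine ceil_log_div_le (by norm_num) ?_ (by linarith) ?_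
    · have := Real.one_sub_inv_le_log_of_pos (show (0 : ℝ) < 4 / 3 by norm_num)
      norm_num at this ⊢
      exact this
    · have e1 : (hessBound d lam σ ε + minProx r ε) / minProx r ε ≤ (2 + z) ^ 2 := by
        rw [add_div, div_self hℓ.ne']
        nlinarith
      have e2 : 1024 * ((hessBound d lam σ ε + minProx r ε) / minProx r ε) ^ 3
          ≤ (2 + z) ^ 16 := by
        calc 1024 * ((hessBound d lam σ ε + minProx r ε) / minProx r ε) ^ 3
            ≤ 2 ^ 10 * ((2 + z) ^ 2) ^ 3 := by
              gcongr
              norm_num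
          _ ≤ (2 + z) ^ 10 * ((2 + z) ^ 2) ^ 3 := by gcongr
          _ = (2 + z) ^ 16 := by rw [← pow_mul, ← pow_add]
      have e3 := Real.log_le_log (by positivity) e2
      rw [Real.log_pow] at e3
      exact_mod_cast e3
  have hJ : ((svmParams d lam σ ε r N).J : ℝ) ≤ 6 * Real.log (2 + z) / (1 / 16) + 1 := by
    refine ceil_log_div_le (by norm_num) ?_ (by linarith) ?_
    · have := Real.one_sub_inv_le_log_of_pos (show (0 : ℝ) < 16 / 15 by norm_num)
      norm_num at this ⊢
      exact this
    · have e2 : 1 + 16 * stabBound d lam σ ε * (3 * lam * d + σ + 1) ^ 2 / minProx r ε ^ 3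
          ≤ (2 + z) ^ 6 := by
        have f1 : 1 ^ 6 + z ^ 6 ≤ (1 + z) ^ 6 :=
          pow_add_pow_le zero_le_one hz0.le (by norm_num)
        have f2 : (1 + z) ^ 6 ≤ (2 + z) ^ 6 := by gcongr; norm_num
        rw [one_pow] at f1
        linarith
      have e3 := Real.log_le_log (by positivity) e2
      rw [Real.log_pow] at e3
      exact_mod_cast e3
  generalize Real.log (2 + z) = l at *
  have hn' : ((svmParams d lam σ ε r N).n : ℝ) ≤ 65 * l := by linarith
  have hJ' : ((svmParams d lam σ ε r N).J : ℝ) + 1 ≤ 97 * l := by linarith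
  push_cast
  have h1 : ((svmParams d lam σ ε r N).n : ℝ) * ((svmParams d lam σ ε r N).J + 1)
      ≤ (65 * l) * (97 * l) := by gcongr
  have h2 : (9 : ℝ) ^ 18 ≤ l ^ 18 := by gcongr
  have h3 : l ^ 20 = l ^ 18 * l ^ 2 := by ring
  have h4 := mul_le_mul_of_nonneg_right h2 (sq_nonneg l)
  rw [h3]
  nlinarith

end Constants

end L1SVM

end

theorem theorem2 :
    ∃ (C : ℝ) (p : ℕ)
      (method : (d m : ℕ) → (lam σ ε : ℝ) → (N : ℕ) → L1SVM.IterMethod d),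
      0 < C ∧
      ∀ (d m : ℕ) (_hm : 0 < m) (lam : ℝ) (_hlam : 0 < lam)
        (a : Fin m → EuclideanSpace ℝ (Fin d)) (b : Fin m → ℝ)
        (x₀ xstar : EuclideanSpace ℝ (Fin d))
        (_hstar : ∀ x, L1SVM.objective lam a b xstar ≤ L1SVM.objective lam a b x)
        (ε : ℝ) (_hε : 0 < ε) (σ R : ℝ) (N : ℕ)
        (O : L1SVM.Query d → EuclideanSpace ℝ (Fin d)),
        σ = L1SVM.gramNorm (L1SVM.dataMatrix a b) →
        R = ‖x₀ - xstar‖ →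
        N = ⌊C * L1SVM.iterBound d lam σ R ε⌋₊ →
        O = L1SVM.answer (L1SVM.smoothed lam a b (L1SVM.smoothingParam d lam ε)) →
          L1SVM.objective lam a b ((method d m lam σ ε N).iterate O x₀ N)
              - L1SVM.objective lam a b xstar ≤ ε ∧
          ∀ k < N, ((method d m lam σ ε N).callsAt O x₀ k : ℝ)
            ≤ C * Real.log (2 + L1SVM.paramZ p d m lam σ R / ε) ^ p := by
  refine ⟨100, 20, fun d _ lam σ ε N =>
    (L1SVM.svmParams d lam σ ε (L1SVM.radius d lam σ ε N) N).method d, by norm_num, ?_⟩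
  intro d m hm lam hlam a b x₀ u hu ε hε σ R N O hσ hR hN hO
  have hR0 : 0 ≤ R := hR ▸ norm_nonneg _
  have hσ0 : 0 ≤ σ := hσ ▸ L1SVM.gramNorm_nonneg _
  rcases Nat.eq_zero_or_pos N with h0 | hN1
  · refine ⟨?_, fun k hk => by omega⟩
    have h1 := (L1SVM.floor_bounds hlam hε hR0 hN).2
    rw [h0, Nat.cast_zero, zero_add, one_pow] at h1
    rw [h0, L1SVM.IterMethod.iterate, L1SVM.IterMethod.stateAt, L1SVM.IterMethod.point_init]
    exact L1SVM.objective_start_sub_le hm hlam hε hσ hR h1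
  · have hd : 0 < d := by
      -- in dimension zero the distance `R` vanishes, and with it the number of iterations
      rcases Nat.eq_zero_or_pos d with h0 | hd
      · subst h0
        have h1 := (L1SVM.floor_bounds hlam hε hR0 hN).1
        have h2 : R = 0 := by rw [hR, Subsingleton.elim (x₀ - u) 0, norm_zero]
        have h3 : (1 : ℝ) ≤ N ^ 5 := one_le_pow₀ (by exact_mod_cast hN1)
        rw [h2] at h1
        norm_num at h1
        linarith
      · exact hd
    subst hO
    refine ⟨L1SVM.objective_iterate_sub_le hm hd hlam hε hu hσ
      (hR ▸ L1SVM.le_radius hlam hε hd hR0 hN) hN1, fun k _ => ?_⟩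
    refine le_trans ?_ (L1SVM.calls_le (m := m) hm hd hlam hε hσ0 hR0 hN hN1)
    exact Nat.cast_le.2 (L1SVM.AccelParams.calls_step_le _ _ _)
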